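/- Let $(\overline M,\overline g,\overline J)$ be an indefinite K\"ahler manifold of real dimension $2m$, $m>1$, and index $2\nu$ with $0<\nu<m$ (that is, $\overline g$ is a pseudo-Riemannian metric with Levi-Civita connection $\overline\nabla$, $\overline J^2=-1$, $\overline g(\overline J\cdot,\overline J\cdot)=\overline g$ and $\overline\nabla\,\overline J=0$). Let $M$ be an immersed lightlike real hypersurface with induced degenerate metric $g_0$, and let $\xi$ be a nowhere vanishing section of the radical bundle $TM^\perp\subset TM$. Assume that $M$ is totally geodesic, i.e. $B(X,Y)=\overline g(\overline\nabla_XY,\xi)=0$ for all $X,Y\in\Gamma(TM)$. Let $S(TM)$ be a screen distribution (a complement of $TM^\perp$ in $TM$) of the form $$S(TM)=\bigl(\overline J(TM^\perp)\oplus\overline J(tr(TM))\bigr)\perp D_0,$$ where $D_0$ is nondegenerate and $\overline J$-invariant, and where the transversal bundle $tr(TM)$ is spanned by the section $N$ with $\overline g(N,\xi)=1$ and $\overline g(N,N)=\overline g(N,W)=0$ for $W\in\Gamma(S(TM))$. Put $\eta=\overline g(N,\cdot)$ and $PX=X-\eta(X)\xi$. Let $D^{g_0}_XY$ be the component of $\overline\nabla_XY$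 in $TM$ with respect to $T\overline M|_M=TM\oplus tr(TM)$, let $C(X,Y)=\eta(D^{g_0}_XY)$ for $Y\in\Gamma(S(TM))$, and let $\varphi_{g_0}$ be the 1-form with $D^{g_0}_X\xi=\varphi_{g_0}(X)\xi$. Assume that $C$ is symmetric on $S(TM)$ (so that $S(TM)$ is integrable). Let $c=[g_0]_0$ be the set of all metrics $e^{-2f}g_0$ with $f\in C^\infty(M)$ and $\xi(f)=0$. Put $\theta_0(X)=\overline g(X,-\overline J\xi)$, let $\theta_0^\sharp$ be the vector field with $g_0(\theta_0^\sharp,\cdot)+\eta(\theta_0^\sharp)\eta=\theta_0$, and let $S$ be the symmetric bilinear form with $S(\xi,\xi)=0$ and $S(X,Y)=C(X,Y)+\eta(X)\theta_0(Y)$ for $X\in\Gamma(TM)$, $Y\in\Gamma(S(TM))$. Then the formula $$D_XY=D^{g_0}_XY+\theta_0(X)Y+\theta_0(Y)X-g_0(X,Y)\theta_0^\sharp-S(X,Y)\xi$$ defines a linear connection $D=D^{\overline J}$ on $M$. It is a Weyl screen structure on $(M,c,S(TM))$: it is torsion-free, for every $g\in c$ there is a unique 1-form $\theta_g$ with $Dg=-2\theta_g\otimes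 g$, and $D_XPY\in\Gamma(S(TM))$ for all $X,Y\in\Gamma(TM)$. For $g=e^{-2f}g_0\in c$ this 1-form is $\theta_g=\theta_0+df$. Moreover $D^{\overline J}$ is closed (that is, $d\theta_g=0$ for every $g\in c$) if and only if $\theta_0$ and $\varphi_{g_0}$ are proportional, i.e. $\varphi_{g_0}=\lambda\,\theta_0$ for some $\lambda\in C^\infty(M)$. -/

import Mathlib

open Bundle Module
open scoped Manifold ContDiff

noncomputable section

namespace LightlikeGeometry

/-! ## Connections, one-forms and symmetric tensors on a manifold -/

section Connections

variable {E : Type*} [NormedAddCommGroup E] [NormedSpace ℝ E]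
  {M : Type*} [TopologicalSpace M] [ChartedSpace E M] [IsManifold 𝓘(ℝ, E) ∞ M]

/-- `X` is a smooth vector field. -/
def IsSmoothField (X : ∀ p : M, TangentSpace 𝓘(ℝ, E) p) : Prop :=
  ContMDiff 𝓘(ℝ, E) 𝓘(ℝ, E).tangent ∞ (fun p ↦ (⟨p, X p⟩ : TangentBundle 𝓘(ℝ, E) M))

/-- The vector field `X` is differentiable at `p`. -/
def DiffFieldAt (X : ∀ p : M, TangentSpace 𝓘(ℝ, E) p) (p : M) : Prop :=
  MDifferentiableAt 𝓘(ℝ, E) 𝓘(ℝ, E).tangent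
    (fun q ↦ (⟨q, X q⟩ : TangentBundle 𝓘(ℝ, E) M)) p

/-- The directional derivative `v · f`. -/
def dirDeriv (f : M → ℝ) (p : M) (v : TangentSpace 𝓘(ℝ, E) p) : ℝ :=
  mvfderiv 𝓘(ℝ, E) f p v

/-- The one-form `θ` is smooth: `θ(X)` is a smooth function for every smooth field `X`. -/
def IsSmoothForm (θ : ∀ p : M, TangentSpace 𝓘(ℝ, E) p →L[ℝ] ℝ) : Prop :=
  ∀ X : ∀ p : M, TangentSpace 𝓘(ℝ, E) p, IsSmoothField X →
    ContMDiff 𝓘(ℝ, E) 𝓘(ℝ, ℝ) ∞ (fun p ↦ θ p (X p))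

/-- The one-form `θ` is closed: `X · θ(Y) - Y · θ(X) - θ([X, Y]) = 0`. -/
def IsClosedForm (θ : ∀ p : M, TangentSpace 𝓘(ℝ, E) p →L[ℝ] ℝ) : Prop :=
  ∀ X Y : ∀ p : M, TangentSpace 𝓘(ℝ, E) p, IsSmoothField X → IsSmoothField Y → ∀ p : M,
    dirDeriv (fun q ↦ θ q (Y q)) p (X p) - dirDeriv (fun q ↦ θ q (X q)) p (Y p)
      - θ p (VectorField.mlieBracket 𝓘(ℝ, E) X Y p) = 0

/-- The connection `D` (with `D Y p (X p) = (D_X Y)(p)`) is torsion-free. -/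
def IsTorsionFree
    (D : CovariantDerivative 𝓘(ℝ, E) E (TangentSpace 𝓘(ℝ, E) : M → Type _)) : Prop :=
  ∀ (p : M) (X Y : ∀ q : M, TangentSpace 𝓘(ℝ, E) q), DiffFieldAt X p → DiffFieldAt Y p →
    D Y p (X p) - D X p (Y p) = VectorField.mlieBracket 𝓘(ℝ, E) X Y p

/-- `D_X Y` is a smooth field whenever `X` and `Y` are. -/
def IsSmoothConnection
    (D : CovariantDerivative 𝓘(ℝ, E) E (TangentSpace 𝓘(ℝ, E) : M → Type _)) : Prop :=
  ∀ X Y : ∀ q : M, TangentSpace 𝓘(ℝ, E) q, IsSmoothField X → IsSmoothField Y →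
    IsSmoothField (fun p ↦ D Y p (X p))

/-- `(D_x g)(Y, Z) = x · g(Y, Z) - g(D_x Y, Z) - g(Y, D_x Z)` at `p`, for `x` tangent at `p`. -/
def covDerivTensor
    (D : CovariantDerivative 𝓘(ℝ, E) E (TangentSpace 𝓘(ℝ, E) : M → Type _))
    (g : ∀ p : M, TangentSpace 𝓘(ℝ, E) p →L[ℝ] TangentSpace 𝓘(ℝ, E) p →L[ℝ] ℝ)
    (Y Z : ∀ q : M, TangentSpace 𝓘(ℝ, E) q) (p : M) (x : TangentSpace 𝓘(ℝ, E) p) : ℝ :=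
  dirDeriv (fun q ↦ g q (Y q) (Z q)) p x - g p (D Y p x) (Z p) - g p (Y p) (D Z p x)

/-- `D g = - 2 θ ⊗ g`. -/
def IsWeylForm
    (D : CovariantDerivative 𝓘(ℝ, E) E (TangentSpace 𝓘(ℝ, E) : M → Type _))
    (g : ∀ p : M, TangentSpace 𝓘(ℝ, E) p →L[ℝ] TangentSpace 𝓘(ℝ, E) p →L[ℝ] ℝ)
    (θ : ∀ p : M, TangentSpace 𝓘(ℝ, E) p →L[ℝ] ℝ) : Prop :=
  ∀ (p : M) (Y Z : ∀ q : M, TangentSpace 𝓘(ℝ, E) q), DiffFieldAt Y p → DiffFieldAt Z p →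
    ∀ x : TangentSpace 𝓘(ℝ, E) p,
      covDerivTensor D g Y Z p x = -2 * θ p x * g p (Y p) (Z p)

end Connections

/-! ## Indefinite Kähler manifolds -/

section Kaehler

variable {F : Type*} [NormedAddCommGroup F] [NormedSpace ℝ F]
  {N : Type*} [TopologicalSpace N] [ChartedSpace F N] [IsManifold 𝓘(ℝ, F) ∞ N]

/-- `g` is a smooth pseudo-Riemannian metric of index `q`. -/
structure IsPseudoMetric
    (g : ∀ x : N, TangentSpace 𝓘(ℝ, F) x →L[ℝ] TangentSpace 𝓘(ℝ, F) x →L[ℝ] ℝ)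
    (q : ℕ) : Prop where
  smooth : ContMDiff 𝓘(ℝ, F) (𝓘(ℝ, F).prod 𝓘(ℝ, F →L[ℝ] F →L[ℝ] ℝ)) ∞
    (fun x ↦ TotalSpace.mk' (F →L[ℝ] F →L[ℝ] ℝ)
      (E := fun x : N ↦ TangentSpace 𝓘(ℝ, F) x →L[ℝ] TangentSpace 𝓘(ℝ, F) x →L[ℝ] ℝ) x (g x))
  symm : ∀ (x : N) (v w : TangentSpace 𝓘(ℝ, F) x), g x v w = g x w v
  nondegenerate : ∀ (x : N) (v : TangentSpace 𝓘(ℝ, F) x), (∀ w, g x v w = 0) → v = 0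
  index : ∀ x : N, sigNeg (LinearMap.BilinMap.toQuadraticMap (g x).toLinearMap₁₂) = q

/-- `∇` is the Levi-Civita connection of `g`. -/
structure IsLeviCivita
    (g : ∀ x : N, TangentSpace 𝓘(ℝ, F) x →L[ℝ] TangentSpace 𝓘(ℝ, F) x →L[ℝ] ℝ)
    (nabla : CovariantDerivative 𝓘(ℝ, F) F (TangentSpace 𝓘(ℝ, F) : N → Type _)) : Prop where
  smooth : CovariantDerivative.ContMDiffCovariantDerivative nabla ∞
  torsionFree : IsTorsionFree nabla
  metric : ∀ (x : N) (Y Z : ∀ y : N, TangentSpace 𝓘(ℝ, F) y),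
    DiffFieldAt Y x → DiffFieldAt Z x → ∀ v, covDerivTensor nabla g Y Z x v = 0

/-- `(N, g, J)` is an indefinite Kähler manifold of index `q`, with Levi-Civita connection `∇`. -/
structure IsIndefiniteKaehler
    (g : ∀ x : N, TangentSpace 𝓘(ℝ, F) x →L[ℝ] TangentSpace 𝓘(ℝ, F) x →L[ℝ] ℝ)
    (J : ∀ x : N, TangentSpace 𝓘(ℝ, F) x →L[ℝ] TangentSpace 𝓘(ℝ, F) x)
    (nabla : CovariantDerivative 𝓘(ℝ, F) F (TangentSpace 𝓘(ℝ, F) : N → Type _))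
    (q : ℕ) : Prop where
  metric : IsPseudoMetric g q
  leviCivita : IsLeviCivita g nabla
  smooth_J : ContMDiff 𝓘(ℝ, F) (𝓘(ℝ, F).prod 𝓘(ℝ, F →L[ℝ] F)) ∞
    (fun x ↦ TotalSpace.mk' (F →L[ℝ] F)
      (E := fun x : N ↦ TangentSpace 𝓘(ℝ, F) x →L[ℝ] TangentSpace 𝓘(ℝ, F) x) x (J x))
  J_sq : ∀ (x : N) (v : TangentSpace 𝓘(ℝ, F) x), J x (J x v) = -v
  hermitian : ∀ (x : N) (v w : TangentSpace 𝓘(ℝ, F) x), g x (J x v) (J x w) = g x v w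
  parallel_J : ∀ (x : N) (Y : ∀ y : N, TangentSpace 𝓘(ℝ, F) y), DiffFieldAt Y x →
    ∀ v, nabla (fun y ↦ J y (Y y)) x v = J x (nabla Y x v)

end Kaehler

/-! ## Lightlike hypersurfaces

`ι : M → N` is the immersion of the hypersurface, `g`, `J`, `nabla` are the metric, the complex
structure and the Levi-Civita connection of the ambient manifold `N`, `ξ` is a section of the
radical distribution, and `n` is a section of the transversal bundle. -/

section Hypersurface

variable {E : Type*} [NormedAddCommGroup E] [NormedSpace ℝ E]
  {M : Type*} [TopologicalSpace M] [ChartedSpace E M] [IsManifold 𝓘(ℝ, E) ∞ M]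
  {F : Type*} [NormedAddCommGroup F] [NormedSpace ℝ F]
  {N : Type*} [TopologicalSpace N] [ChartedSpace F N] [IsManifold 𝓘(ℝ, F) ∞ N]

/-- `ι_* Y`, a vector field along `ι`. -/
def push (ι : M → N) (Y : ∀ p : M, TangentSpace 𝓘(ℝ, E) p) (p : M) :
    TangentSpace 𝓘(ℝ, F) (ι p) :=
  mfderiv 𝓘(ℝ, E) 𝓘(ℝ, F) ι p (Y p)

/-- The field `W` along `ι` is smooth. -/
def IsSmoothAlong (ι : M → N) (W : ∀ p : M, TangentSpace 𝓘(ℝ, F) (ι p)) : Prop :=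
  ContMDiff 𝓘(ℝ, E) 𝓘(ℝ, F).tangent ∞ (fun p ↦ (⟨ι p, W p⟩ : TangentBundle 𝓘(ℝ, F) N))

/-- The covariant derivative `∇_v W` of a vector field `W` along `ι`, for `v` tangent to `M` at `p`.
In the coordinate frame `e_i` of the preferred chart at `ι p`, where `W = ∑ w^i (e_i ∘ ι)`, it is
`∑ dw^i(v) e_i + ∑ w^i(p) ∇_{ι_* v} e_i`. -/
def alongDeriv (ι : M → N)
    (nabla : CovariantDerivative 𝓘(ℝ, F) F (TangentSpace 𝓘(ℝ, F) : N → Type _))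
    (W : ∀ p : M, TangentSpace 𝓘(ℝ, F) (ι p)) (p : M) :
    TangentSpace 𝓘(ℝ, E) p →L[ℝ] TangentSpace 𝓘(ℝ, F) (ι p) :=
  let t := trivializationAt F (TangentSpace 𝓘(ℝ, F) : N → Type _) (ι p)
  let w : M → F := fun q ↦ t.continuousLinearMapAt ℝ (ι q) (W q)
  (t.symmL ℝ (ι p)).comp (mvfderiv 𝓘(ℝ, E) w p) +
    (nabla (fun y ↦ t.symmL ℝ y (w p)) (ι p)).comp (mfderiv 𝓘(ℝ, E) 𝓘(ℝ, F) ι p)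

/-- The induced (degenerate) metric `g₀ = ι^* g`. -/
def inducedMetric (ι : M → N)
    (g : ∀ x : N, TangentSpace 𝓘(ℝ, F) x →L[ℝ] TangentSpace 𝓘(ℝ, F) x →L[ℝ] ℝ) (p : M) :
    TangentSpace 𝓘(ℝ, E) p →L[ℝ] TangentSpace 𝓘(ℝ, E) p →L[ℝ] ℝ :=
  ((mfderiv 𝓘(ℝ, E) 𝓘(ℝ, F) ι p).precomp ℝ).comp
    ((g (ι p)).comp (mfderiv 𝓘(ℝ, E) 𝓘(ℝ, F) ι p))

/-- The metric `e^{-2f} g₀`. -/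
def conformalMetric
    (g₀ : ∀ p : M, TangentSpace 𝓘(ℝ, E) p →L[ℝ] TangentSpace 𝓘(ℝ, E) p →L[ℝ] ℝ)
    (f : M → ℝ) (p : M) :
    TangentSpace 𝓘(ℝ, E) p →L[ℝ] TangentSpace 𝓘(ℝ, E) p →L[ℝ] ℝ :=
  Real.exp (-2 * f p) • g₀ p

/-- The functions `f` for which `e^{-2f} g₀` belongs to the conformal structure `c = [g₀]₀`:
smooth and constant along the orbits of `ξ`. -/
structure IsConformalFactor (ξ : ∀ p : M, TangentSpace 𝓘(ℝ, E) p) (f : M → ℝ) : Prop where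
  smooth : ContMDiff 𝓘(ℝ, E) 𝓘(ℝ, ℝ) ∞ f
  radial : ∀ p : M, dirDeriv f p (ξ p) = 0

/-- `ξ` is a smooth nowhere vanishing section of the normal bundle `TM^⊥ ⊂ TM`. -/
structure IsRadicalSection (ι : M → N)
    (g : ∀ x : N, TangentSpace 𝓘(ℝ, F) x →L[ℝ] TangentSpace 𝓘(ℝ, F) x →L[ℝ] ℝ)
    (ξ : ∀ p : M, TangentSpace 𝓘(ℝ, E) p) : Prop where
  smooth : IsSmoothField ξ
  ne_zero : ∀ p : M, ξ p ≠ 0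
  radical : ∀ (p : M) (x : TangentSpace 𝓘(ℝ, E) p), inducedMetric ι g p (ξ p) x = 0

/-- `S` is a screen distribution (a complement of `TM^⊥` in `TM`), and `n` is the smooth section of
the corresponding lightlike transversal bundle normalized by `g(n, ξ) = 1`. -/
structure IsScreen (ι : M → N)
    (g : ∀ x : N, TangentSpace 𝓘(ℝ, F) x →L[ℝ] TangentSpace 𝓘(ℝ, F) x →L[ℝ] ℝ)
    (ξ : ∀ p : M, TangentSpace 𝓘(ℝ, E) p)
    (S : ∀ p : M, Submodule ℝ (TangentSpace 𝓘(ℝ, E) p))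
    (n : ∀ p : M, TangentSpace 𝓘(ℝ, F) (ι p)) : Prop where
  compl : ∀ p : M, IsCompl (S p) (Submodule.span ℝ {ξ p})
  smooth : IsSmoothAlong (E := E) ι n
  normalized : ∀ p : M, g (ι p) (n p) (push ι ξ p) = 1
  null : ∀ p : M, g (ι p) (n p) (n p) = 0
  orthogonal : ∀ (p : M) (w : TangentSpace 𝓘(ℝ, E) p), w ∈ S p →
    g (ι p) (n p) (mfderiv 𝓘(ℝ, E) 𝓘(ℝ, F) ι p w) = 0

/-- `S = (J(TM^⊥) ⊕ J(tr TM)) ⊥ D₀`, where `D₀` is nondegenerate and `J`-invariant. -/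
def IsAdaptedScreen (ι : M → N)
    (g : ∀ x : N, TangentSpace 𝓘(ℝ, F) x →L[ℝ] TangentSpace 𝓘(ℝ, F) x →L[ℝ] ℝ)
    (J : ∀ x : N, TangentSpace 𝓘(ℝ, F) x →L[ℝ] TangentSpace 𝓘(ℝ, F) x)
    (ξ : ∀ p : M, TangentSpace 𝓘(ℝ, E) p)
    (S : ∀ p : M, Submodule ℝ (TangentSpace 𝓘(ℝ, E) p))
    (n : ∀ p : M, TangentSpace 𝓘(ℝ, F) (ι p)) : Prop :=
  ∀ p : M, ∃ D₀ : Submodule ℝ (TangentSpace 𝓘(ℝ, F) (ι p)),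
    (S p).map (mfderiv 𝓘(ℝ, E) 𝓘(ℝ, F) ι p).toLinearMap =
      Submodule.span ℝ {J (ι p) (push ι ξ p), J (ι p) (n p)} ⊔ D₀ ∧
    Disjoint (Submodule.span ℝ {J (ι p) (push ι ξ p)}) (Submodule.span ℝ {J (ι p) (n p)}) ∧
    (∀ w ∈ D₀, g (ι p) (J (ι p) (push ι ξ p)) w = 0 ∧ g (ι p) (J (ι p) (n p)) w = 0) ∧
    (∀ w ∈ D₀, J (ι p) w ∈ D₀) ∧
    (∀ v ∈ D₀, (∀ w ∈ D₀, g (ι p) v w = 0) → v = 0)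

/-- The hypersurface is totally geodesic: its second fundamental form
`B(X, Y) = g(∇_X Y, ξ)` vanishes. -/
def IsTotallyGeodesic (ι : M → N)
    (g : ∀ x : N, TangentSpace 𝓘(ℝ, F) x →L[ℝ] TangentSpace 𝓘(ℝ, F) x →L[ℝ] ℝ)
    (nabla : CovariantDerivative 𝓘(ℝ, F) F (TangentSpace 𝓘(ℝ, F) : N → Type _))
    (ξ : ∀ p : M, TangentSpace 𝓘(ℝ, E) p) : Prop :=
  ∀ (p : M) (Y : ∀ q : M, TangentSpace 𝓘(ℝ, E) q), DiffFieldAt Y p →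
    ∀ x : TangentSpace 𝓘(ℝ, E) p, g (ι p) (alongDeriv ι nabla (push ι Y) p x) (push ι ξ p) = 0

/-- The projection of `TN|_M = TM ⊕ tr(TM)` onto `TM`, where `tr(TM)` is spanned by `n`. -/
def tangentProj (ι : M → N) (n : ∀ p : M, TangentSpace 𝓘(ℝ, F) (ι p)) (p : M) :
    TangentSpace 𝓘(ℝ, F) (ι p) →L[ℝ] TangentSpace 𝓘(ℝ, E) p :=
  (ContinuousLinearMap.fst ℝ (TangentSpace 𝓘(ℝ, E) p) ℝ).comp
    ((mfderiv 𝓘(ℝ, E) 𝓘(ℝ, F) ι p).coprod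
      (ContinuousLinearMap.toSpanSingleton ℝ (n p))).inverse

/-- The connection `D^{g₀}` induced on `M`: the tangential part of `∇_X Y`. -/
def inducedConnection (ι : M → N)
    (nabla : CovariantDerivative 𝓘(ℝ, F) F (TangentSpace 𝓘(ℝ, F) : N → Type _))
    (n : ∀ p : M, TangentSpace 𝓘(ℝ, F) (ι p))
    (Y : ∀ q : M, TangentSpace 𝓘(ℝ, E) q) (p : M) :
    TangentSpace 𝓘(ℝ, E) p →L[ℝ] TangentSpace 𝓘(ℝ, E) p :=
  (tangentProj ι n p).comp (alongDeriv ι nabla (push ι Y) p)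

/-- The one-form `η = g(n, ·)` on `M`. -/
def eta (ι : M → N)
    (g : ∀ x : N, TangentSpace 𝓘(ℝ, F) x →L[ℝ] TangentSpace 𝓘(ℝ, F) x →L[ℝ] ℝ)
    (n : ∀ p : M, TangentSpace 𝓘(ℝ, F) (ι p)) (p : M) : TangentSpace 𝓘(ℝ, E) p →L[ℝ] ℝ :=
  (g (ι p) (n p)).comp (mfderiv 𝓘(ℝ, E) 𝓘(ℝ, F) ι p)

/-- The projection `P` of `TM = S ⊥ TM^⊥` onto the screen: `P X = X - η(X) ξ`. -/
def screenProj (ι : M → N)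
    (g : ∀ x : N, TangentSpace 𝓘(ℝ, F) x →L[ℝ] TangentSpace 𝓘(ℝ, F) x →L[ℝ] ℝ)
    (ξ : ∀ p : M, TangentSpace 𝓘(ℝ, E) p) (n : ∀ p : M, TangentSpace 𝓘(ℝ, F) (ι p))
    (X : ∀ q : M, TangentSpace 𝓘(ℝ, E) q) (p : M) : TangentSpace 𝓘(ℝ, E) p :=
  X p - eta ι g n p (X p) • ξ p

/-- The second fundamental form of the screen: `C(x, Y) = η(D^{g₀}_x Y)`, the coefficient of `ξ` in
`D^{g₀}_x Y`, for a section `Y` of the screen. -/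
def screenForm (ι : M → N)
    (g : ∀ x : N, TangentSpace 𝓘(ℝ, F) x →L[ℝ] TangentSpace 𝓘(ℝ, F) x →L[ℝ] ℝ)
    (nabla : CovariantDerivative 𝓘(ℝ, F) F (TangentSpace 𝓘(ℝ, F) : N → Type _))
    (n : ∀ p : M, TangentSpace 𝓘(ℝ, F) (ι p)) (p : M) (x : TangentSpace 𝓘(ℝ, E) p)
    (Y : ∀ q : M, TangentSpace 𝓘(ℝ, E) q) : ℝ :=
  eta ι g n p (inducedConnection ι nabla n Y p x)

/-- `C` is symmetric on the screen. -/
def IsSymmetricScreenForm (ι : M → N)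
    (g : ∀ x : N, TangentSpace 𝓘(ℝ, F) x →L[ℝ] TangentSpace 𝓘(ℝ, F) x →L[ℝ] ℝ)
    (nabla : CovariantDerivative 𝓘(ℝ, F) F (TangentSpace 𝓘(ℝ, F) : N → Type _))
    (S : ∀ p : M, Submodule ℝ (TangentSpace 𝓘(ℝ, E) p))
    (n : ∀ p : M, TangentSpace 𝓘(ℝ, F) (ι p)) : Prop :=
  ∀ (p : M) (X Y : ∀ q : M, TangentSpace 𝓘(ℝ, E) q),
    DiffFieldAt X p → DiffFieldAt Y p → (∀ q, X q ∈ S q) → (∀ q, Y q ∈ S q) →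
      screenForm ι g nabla n p (X p) Y = screenForm ι g nabla n p (Y p) X

/-- The one-form `φ` with `D^{g₀}_X ξ = φ(X) ξ` (in the totally geodesic case). -/
def phi (ι : M → N)
    (g : ∀ x : N, TangentSpace 𝓘(ℝ, F) x →L[ℝ] TangentSpace 𝓘(ℝ, F) x →L[ℝ] ℝ)
    (nabla : CovariantDerivative 𝓘(ℝ, F) F (TangentSpace 𝓘(ℝ, F) : N → Type _))
    (ξ : ∀ p : M, TangentSpace 𝓘(ℝ, E) p) (n : ∀ p : M, TangentSpace 𝓘(ℝ, F) (ι p)) (p : M) :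
    TangentSpace 𝓘(ℝ, E) p →L[ℝ] ℝ :=
  (eta ι g n p).comp (inducedConnection ι nabla n ξ p)

/-- The one-form `θ₀(X) = g(V, X)` with `V = -J ξ`. -/
def theta₀ (ι : M → N)
    (g : ∀ x : N, TangentSpace 𝓘(ℝ, F) x →L[ℝ] TangentSpace 𝓘(ℝ, F) x →L[ℝ] ℝ)
    (J : ∀ x : N, TangentSpace 𝓘(ℝ, F) x →L[ℝ] TangentSpace 𝓘(ℝ, F) x)
    (ξ : ∀ p : M, TangentSpace 𝓘(ℝ, E) p) (p : M) : TangentSpace 𝓘(ℝ, E) p →L[ℝ] ℝ :=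
  (g (ι p) (-J (ι p) (push ι ξ p))).comp (mfderiv 𝓘(ℝ, E) 𝓘(ℝ, F) ι p)

/-- The map `X ↦ X^♭ = g₀(X, ·) + η(X) η`. -/
def flat (ι : M → N)
    (g : ∀ x : N, TangentSpace 𝓘(ℝ, F) x →L[ℝ] TangentSpace 𝓘(ℝ, F) x →L[ℝ] ℝ)
    (n : ∀ p : M, TangentSpace 𝓘(ℝ, F) (ι p)) (p : M) :
    TangentSpace 𝓘(ℝ, E) p →L[ℝ] (TangentSpace 𝓘(ℝ, E) p →L[ℝ] ℝ) :=
  inducedMetric ι g p + (eta ι g n p).smulRight (eta ι g n p)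

/-- The dual vector field `θ^♯`, where `♯` is the inverse of `♭`. -/
def sharp (ι : M → N)
    (g : ∀ x : N, TangentSpace 𝓘(ℝ, F) x →L[ℝ] TangentSpace 𝓘(ℝ, F) x →L[ℝ] ℝ)
    (n : ∀ p : M, TangentSpace 𝓘(ℝ, F) (ι p))
    (θ : ∀ p : M, TangentSpace 𝓘(ℝ, E) p →L[ℝ] ℝ) (p : M) : TangentSpace 𝓘(ℝ, E) p :=
  (flat ι g n p).inverse (θ p)

/-- The symmetric form `S(X, Y)` with `S(ξ, ξ) = 0` and `S(X, Y) = C(X, Y) + η(X) θ(Y)` for `Y`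
in the screen, written out through `X = P X + η(X) ξ` and `Y = P Y + η(Y) ξ`. -/
def correctionForm (ι : M → N)
    (g : ∀ x : N, TangentSpace 𝓘(ℝ, F) x →L[ℝ] TangentSpace 𝓘(ℝ, F) x →L[ℝ] ℝ)
    (nabla : CovariantDerivative 𝓘(ℝ, F) F (TangentSpace 𝓘(ℝ, F) : N → Type _))
    (ξ : ∀ p : M, TangentSpace 𝓘(ℝ, E) p) (n : ∀ p : M, TangentSpace 𝓘(ℝ, F) (ι p))
    (θ : ∀ p : M, TangentSpace 𝓘(ℝ, E) p →L[ℝ] ℝ)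
    (X Y : ∀ q : M, TangentSpace 𝓘(ℝ, E) q) (p : M) : ℝ :=
  (screenForm ι g nabla n p (X p) (screenProj ι g ξ n Y)
      + eta ι g n p (X p) * θ p (screenProj ι g ξ n Y p))
    + eta ι g n p (Y p) *
      (screenForm ι g nabla n p (ξ p) (screenProj ι g ξ n X) + θ p (screenProj ι g ξ n X p))

/-- `D` is the connection with data `g₀` and `θ`:
`D_X Y = D^{g₀}_X Y + θ(X) Y + θ(Y) X - g₀(X, Y) θ^♯ - S(X, Y) ξ`. -/
def HasScreenData (ι : M → N)
    (g : ∀ x : N, TangentSpace 𝓘(ℝ, F) x →L[ℝ] TangentSpace 𝓘(ℝ, F) x →L[ℝ] ℝ)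
    (nabla : CovariantDerivative 𝓘(ℝ, F) F (TangentSpace 𝓘(ℝ, F) : N → Type _))
    (ξ : ∀ p : M, TangentSpace 𝓘(ℝ, E) p) (n : ∀ p : M, TangentSpace 𝓘(ℝ, F) (ι p))
    (θ : ∀ p : M, TangentSpace 𝓘(ℝ, E) p →L[ℝ] ℝ)
    (D : CovariantDerivative 𝓘(ℝ, E) E (TangentSpace 𝓘(ℝ, E) : M → Type _)) : Prop :=
  ∀ (p : M) (X Y : ∀ q : M, TangentSpace 𝓘(ℝ, E) q), DiffFieldAt X p → DiffFieldAt Y p →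
    D Y p (X p) = inducedConnection ι nabla n Y p (X p) + θ p (X p) • Y p + θ p (Y p) • X p
      - inducedMetric ι g p (X p) (Y p) • sharp ι g n θ p
      - correctionForm ι g nabla ξ n θ X Y p • ξ p

/-- `D` is a Weyl structure relative to `(M, c = [g₀]₀)`: a torsion-free linear connection such that
for every `g = e^{-2f} g₀` in `c` there is a unique one-form `θ` with `D g = -2 θ ⊗ g`. -/
structure IsWeylStructure
    (g₀ : ∀ p : M, TangentSpace 𝓘(ℝ, E) p →L[ℝ] TangentSpace 𝓘(ℝ, E) p →L[ℝ] ℝ)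
    (ξ : ∀ p : M, TangentSpace 𝓘(ℝ, E) p)
    (D : CovariantDerivative 𝓘(ℝ, E) E (TangentSpace 𝓘(ℝ, E) : M → Type _)) : Prop where
  smooth : IsSmoothConnection D
  torsionFree : IsTorsionFree D
  preserves : ∀ f : M → ℝ, IsConformalFactor ξ f →
    ∃! θ : ∀ p : M, TangentSpace 𝓘(ℝ, E) p →L[ℝ] ℝ,
      IsSmoothForm θ ∧ IsWeylForm D (conformalMetric g₀ f) θ

/-- `D` is a Weyl screen structure: a Weyl structure for which the screen is parallel. -/
structure IsWeylScreenStructure (ι : M → N)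
    (g : ∀ x : N, TangentSpace 𝓘(ℝ, F) x →L[ℝ] TangentSpace 𝓘(ℝ, F) x →L[ℝ] ℝ)
    (ξ : ∀ p : M, TangentSpace 𝓘(ℝ, E) p)
    (S : ∀ p : M, Submodule ℝ (TangentSpace 𝓘(ℝ, E) p))
    (n : ∀ p : M, TangentSpace 𝓘(ℝ, F) (ι p))
    (D : CovariantDerivative 𝓘(ℝ, E) E (TangentSpace 𝓘(ℝ, E) : M → Type _)) : Prop where
  weyl : IsWeylStructure (inducedMetric ι g) ξ D
  parallel : ∀ (p : M) (Y : ∀ q : M, TangentSpace 𝓘(ℝ, E) q), DiffFieldAt Y p →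
    ∀ x : TangentSpace 𝓘(ℝ, E) p, D (screenProj ι g ξ n Y) p x ∈ S p

/-- A Weyl structure is closed if its one-form with respect to every metric of `c` is closed. -/
def IsClosedWeylStructure
    (g₀ : ∀ p : M, TangentSpace 𝓘(ℝ, E) p →L[ℝ] TangentSpace 𝓘(ℝ, E) p →L[ℝ] ℝ)
    (ξ : ∀ p : M, TangentSpace 𝓘(ℝ, E) p)
    (D : CovariantDerivative 𝓘(ℝ, E) E (TangentSpace 𝓘(ℝ, E) : M → Type _)) : Prop :=
  ∀ f : M → ℝ, IsConformalFactor ξ f → ∀ θ : ∀ p : M, TangentSpace 𝓘(ℝ, E) p →L[ℝ] ℝ,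
    IsSmoothForm θ → IsWeylForm D (conformalMetric g₀ f) θ → IsClosedForm θ

end Hypersurface

end LightlikeGeometry

end

open scoped Topology

noncomputable section

set_option linter.unusedSectionVars false

/-! Since `B = 0`, the ambient derivative of a tangent field is again tangent. The induced
connection `D^{g₀}` is therefore torsion-free, satisfies `D^{g₀} g₀ = 0`, and has `D^{g₀} ξ = φ ⊗ ξ`
because `ξ` spans the radical of `g₀` (`eq_smul_radical`).

Write `V = -Jξ` and `U = JN`. Both lie in the screen, so `η(V) = 0` and `θ₀^♯ = V`, while `θ₀(U) =
-g(ξ, N) = -1`. Existence of `D` requires every term added to `D^{g₀}` to be tensorial. The only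
doubtful one is `C`, and differentiating `g(N, PY) = 0` gives `C(X, PY) = -g(∇_X N, PY)`
(`screenForm_screenProj`). Symmetry of `C` on the screen makes `S` symmetric, hence `D`
torsion-free. The term `S ξ` is invisible to `g₀`, and the rest is the usual Weyl correction, so `D
g₀ = -2 θ₀ ⊗ g₀`; the factor `e^{-2f}` adds `df` (`isWeylForm`). Uniqueness of the form holds
because `g₀(V, U) = -1` is nonzero. Finally `S` is chosen so that the `ξ`-component of `D_X PY`
cancels.

For closedness, `∇J = 0` gives `∇_X V = -J ∇_X ξ = φ(X) V`, hence `dθ₀ = φ ∧ θ₀`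
(`exteriorDeriv_theta₀`). As `d(df) = 0`, closedness of all `θ₀ + df` means `φ ∧ θ₀ = 0`; evaluation
at `U` turns this into `φ = -φ(U) θ₀`.

The remaining work is calculus for fields along `ι`. `alongDeriv` is defined in a chart, and its
compatibility with `g` and `J` must be derived from that of `nabla`. The defect in each identity is
linear over functions, so it depends only on values at the point (`TensorialAlongAt.congr`), and it
suffices to test chart frames, which are restrictions of ambient fields. The torsion identity
instead follows from a commutator formula for vector-valued functions (`mvfderiv_commutator`). -/

namespace LightlikeGeometry

/-! ### Lie brackets and second derivatives in the preferred chart. -/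

section
variable {E : Type*} [NormedAddCommGroup E] [NormedSpace ℝ E]
  {M : Type*} [TopologicalSpace M] [ChartedSpace E M] [IsManifold 𝓘(ℝ, E) ∞ M]
  {G : Type*} [NormedAddCommGroup G] [NormedSpace ℝ G]

/-- The coordinate expression of a vector field in the preferred chart at `p`. -/
def coordField (p : M) (X : ∀ q : M, TangentSpace 𝓘(ℝ, E) q) : E → E :=
  VectorField.mpullbackWithin 𝓘(ℝ, E) 𝓘(ℝ, E) (extChartAt 𝓘(ℝ, E) p).symm X (Set.range 𝓘(ℝ, E))

variable [CompleteSpace E] in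
theorem DiffFieldAt.differentiableAt_coordField {p : M} {X : ∀ q : M, TangentSpace 𝓘(ℝ, E) q}
    (hX : DiffFieldAt X p) : DifferentiableAt ℝ (coordField p X) (extChartAt 𝓘(ℝ, E) p p) := by
  have : IsManifold 𝓘(ℝ, E) 2 M := .of_le (n := ∞) (WithTop.coe_le_coe.2 le_top)
  have := MDifferentiableWithinAt.differentiableWithinAt_mpullbackWithin_vectorField
    (s := Set.univ) (V := X) (x := p) (I := 𝓘(ℝ, E)) (hX.mdifferentiableWithinAt)
  refine DifferentiableWithinAt.differentiableAt this ?_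
  simp

/-- The tangent space at `p` is modelled through the preferred chart at `p`, so the derivative of
that chart at `p` itself is the identity and no transport is needed. -/
theorem mlieBracket_eq_lieBracket_coordField (p : M) (X Y : ∀ q : M, TangentSpace 𝓘(ℝ, E) q) :
    VectorField.mlieBracket 𝓘(ℝ, E) X Y p =
      VectorField.lieBracket ℝ (coordField p X) (coordField p Y) (extChartAt 𝓘(ℝ, E) p p) := by
  have : IsManifold 𝓘(ℝ, E) 1 M := .of_le (n := ∞) (WithTop.coe_le_coe.2 le_top)
  have h : (mfderiv 𝓘(ℝ, E) 𝓘(ℝ, E) (extChartAt 𝓘(ℝ, E) p) p).inverse =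
      ContinuousLinearMap.id ℝ E := by
    rw [mfderiv_extChartAt_self]
    exact ContinuousLinearMap.inverse_id
  refine (congrArg (fun L : E →L[ℝ] E ↦ L _) h).trans ?_
  have h2 : (extChartAt 𝓘(ℝ, E) p).symm ⁻¹' Set.univ ∩ Set.range 𝓘(ℝ, E) = Set.univ := by simp
  refine (congrArg (fun s ↦ VectorField.lieBracketWithin ℝ (coordField p X) (coordField p Y) s
    (extChartAt 𝓘(ℝ, E) p p)) h2).trans ?_
  rw [VectorField.lieBracketWithin_univ]

theorem mvfderiv_eq_fderiv {p q : M} (hq : q ∈ (chartAt E p).source) {f : M → G}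
    (hf : MDifferentiableAt 𝓘(ℝ, E) 𝓘(ℝ, G) f q) (X : ∀ q : M, TangentSpace 𝓘(ℝ, E) q) :
    mvfderiv 𝓘(ℝ, E) f q (X q) =
      fderiv ℝ (f ∘ (extChartAt 𝓘(ℝ, E) p).symm) (extChartAt 𝓘(ℝ, E) p q)
        (coordField p X (extChartAt 𝓘(ℝ, E) p q)) := by
  have : IsManifold 𝓘(ℝ, E) 1 M := .of_le (n := ∞) (WithTop.coe_le_coe.2 le_top)
  set φ := extChartAt 𝓘(ℝ, E) p with hφ
  have hq' : q ∈ φ.source := by rwa [hφ, extChartAt_source]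
  have hz : φ q ∈ φ.target := φ.map_source hq'
  have hinv : φ.symm (φ q) = q := φ.left_inv hq'
  have hψ : MDifferentiableAt 𝓘(ℝ, E) 𝓘(ℝ, E) φ.symm (φ q) := by
    exact (mdifferentiableWithinAt_extChartAt_symm (I := 𝓘(ℝ, E)) hz).mdifferentiableAt (by simp)
  have hI : (mfderivWithin 𝓘(ℝ, E) 𝓘(ℝ, E) φ.symm (Set.range 𝓘(ℝ, E)) (φ q)).IsInvertible :=
    isInvertible_mfderivWithin_extChartAt_symm hz
  have hrange : Set.range 𝓘(ℝ, E) = Set.univ := by simp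
  have hD : mfderiv 𝓘(ℝ, E) 𝓘(ℝ, E) φ.symm (φ q) (coordField (E := E) p X (φ q)) =
      X (φ.symm (φ q)) := by
    rw [← mfderivWithin_univ, ← hrange]
    exact hI.self_apply_inverse _
  have hf' : MDifferentiableAt 𝓘(ℝ, E) 𝓘(ℝ, G) f (φ.symm (φ q)) := by rwa [hinv]
  have hc := mfderiv_comp_apply (φ q) hf' hψ (coordField (E := E) p X (φ q))
  rw [mfderiv_eq_fderiv] at hc
  refine Eq.trans ?_ hc.symm
  refine Eq.trans ?_ (congrArg (mfderiv 𝓘(ℝ, E) 𝓘(ℝ, G) f (φ.symm (φ q))) hD.symm)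
  change mfderiv 𝓘(ℝ, E) 𝓘(ℝ, G) f q (X q) = _
  -- The two tangent spaces sit over points that are only propositionally equal; generalizing the
  -- point allows substitution.
  generalize φ.symm (φ q) = q' at hinv 
  subst hinv
  rfl

variable [CompleteSpace E] in
-- In the chart this is symmetry of the second derivative. Vector values matter: the formula is
-- applied to a chart, to a chart composed with `ι`, and, for `d(df) = 0`, to a real function.
theorem mvfderiv_commutator {p : M} {f : M → G} (hf : ContMDiffAt 𝓘(ℝ, E) 𝓘(ℝ, G) 2 f p)
    {X Y : ∀ q : M, TangentSpace 𝓘(ℝ, E) q} (hX : DiffFieldAt X p) (hY : DiffFieldAt Y p)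
    (hXf : MDifferentiableAt 𝓘(ℝ, E) 𝓘(ℝ, G) (fun q ↦ mvfderiv 𝓘(ℝ, E) f q (X q)) p)
    (hYf : MDifferentiableAt 𝓘(ℝ, E) 𝓘(ℝ, G) (fun q ↦ mvfderiv 𝓘(ℝ, E) f q (Y q)) p) :
    mvfderiv 𝓘(ℝ, E) (fun q ↦ mvfderiv 𝓘(ℝ, E) f q (Y q)) p (X p) -
      mvfderiv 𝓘(ℝ, E) (fun q ↦ mvfderiv 𝓘(ℝ, E) f q (X q)) p (Y p) =
      mvfderiv 𝓘(ℝ, E) f p (VectorField.mlieBracket 𝓘(ℝ, E) X Y p) := by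
  have : IsManifold 𝓘(ℝ, E) 2 M := .of_le (n := ∞) (WithTop.coe_le_coe.2 le_top)
  set φ := extChartAt 𝓘(ℝ, E) p with hφ
  have hp : p ∈ (chartAt E p).source := mem_chart_source E p
  have hf2 : ContDiffAt ℝ 2 (f ∘ φ.symm) (φ p) := by
    have := (contMDiffAt_iff.1 hf).2
    exact this.contDiffAt (by simp)
  have hnear : ∀ᶠ q in 𝓝 p, q ∈ (chartAt E p).source ∧ MDifferentiableAt 𝓘(ℝ, E) 𝓘(ℝ, G) f q := by
    have h1 : ∀ᶠ q in 𝓝 p, q ∈ (chartAt E p).source :=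
      (chartAt E p).open_source.mem_nhds hp
    have h2 := (contMDiffAt_iff_contMDiffAt_nhds (by decide)).1 hf
    filter_upwards [h1, h2] with q h1 h2
    exact ⟨h1, h2.mdifferentiableAt (by decide)⟩
  have hs : Filter.Tendsto φ.symm (𝓝 (φ p)) (𝓝 p) := by
    have := continuousAt_extChartAt_symm (I := 𝓘(ℝ, E)) p
    have h2 : φ.symm (φ p) = p := extChartAt_to_inv p
    rw [ContinuousAt] at this
    rwa [← hφ, h2] at this
  have key : ∀ Z : (∀ q : M, TangentSpace 𝓘(ℝ, E) q),
      ((fun q ↦ mvfderiv 𝓘(ℝ, E) f q (Z q)) ∘ φ.symm) =ᶠ[𝓝 (φ p)]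
        fun z ↦ fderiv ℝ (f ∘ φ.symm) z (coordField p Z z) := by
    intro Z
    have ht : φ.target ∈ 𝓝 (φ p) := extChartAt_target_mem_nhds p
    filter_upwards [hs.eventually hnear, ht] with z hz hzt
    have := mvfderiv_eq_fderiv hz.1 hz.2 Z
    rw [← hφ, φ.right_inv hzt] at this
    exact this
  rw [mvfderiv_eq_fderiv hp hXf Y, mvfderiv_eq_fderiv hp hYf X]
  have hB := mvfderiv_eq_fderiv hp (hf.mdifferentiableAt (by decide))
    (VectorField.mlieBracket 𝓘(ℝ, E) X Y)
  have hB2 : coordField p (VectorField.mlieBracket 𝓘(ℝ, E) X Y) (φ p) =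
      VectorField.lieBracket ℝ (coordField p X) (coordField p Y) (φ p) := by
    rw [← mlieBracket_eq_lieBracket_coordField]
    have h3 : (mfderivWithin 𝓘(ℝ, E) 𝓘(ℝ, E) φ.symm (Set.range 𝓘(ℝ, E)) (φ p)).inverse =
      ContinuousLinearMap.id ℝ E := by
      rw [mfderivWithin_range_extChartAt_symm]
      exact ContinuousLinearMap.inverse_id
    refine (congrArg (fun L : E →L[ℝ] E ↦ L _) h3).trans ?_
    change VectorField.mlieBracket 𝓘(ℝ, E) X Y (φ.symm (φ p)) = _
    rw [extChartAt_to_inv p]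
  rw [hB, ← hφ, hB2, (key Y).fderiv_eq, (key X).fderiv_eq]
  exact (VectorField.fderiv_apply_lieBracket hf2 (by simp) hY.differentiableAt_coordField
    hX.differentiableAt_coordField).symm

end

/-! ### Regularity of derivatives along fields, and extension of tangent vectors to smooth fields.
-/

section

variable {E : Type*} [NormedAddCommGroup E] [NormedSpace ℝ E]
  {M : Type*} [TopologicalSpace M] [ChartedSpace E M] [IsManifold 𝓘(ℝ, E) ∞ M]
  {F : Type*} [NormedAddCommGroup F] [NormedSpace ℝ F]
  {N : Type*} [TopologicalSpace N] [ChartedSpace F N] [IsManifold 𝓘(ℝ, F) ∞ N]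
  {G : Type*} [NormedAddCommGroup G] [NormedSpace ℝ G]

theorem contMDiffAt_mfderiv_apply {f : M → N} {p : M}
    (hf : ContMDiffAt 𝓘(ℝ, E) 𝓘(ℝ, F) ∞ f p) {X : ∀ q : M, TangentSpace 𝓘(ℝ, E) q}
    (hX : ContMDiffAt 𝓘(ℝ, E) 𝓘(ℝ, E).tangent ∞
      (fun q ↦ (⟨q, X q⟩ : TangentBundle 𝓘(ℝ, E) M)) p) :
    ContMDiffAt 𝓘(ℝ, E) 𝓘(ℝ, F).tangent ∞
      (fun q ↦ (⟨f q, mfderiv 𝓘(ℝ, E) 𝓘(ℝ, F) f q (X q)⟩ : TangentBundle 𝓘(ℝ, F) N)) p := by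
  have : IsManifold 𝓘(ℝ, E) 1 M := .of_le (n := ∞) (WithTop.coe_le_coe.2 le_top)
  have : IsManifold 𝓘(ℝ, F) 1 N := .of_le (n := ∞) (WithTop.coe_le_coe.2 le_top)
  exact ContMDiffAt.clm_apply_of_inCoordinates (hf.mfderiv_const (m := ∞) le_rfl) hX hf

theorem mdifferentiableAt_mfderiv_apply {f : M → N} {p : M}
    (hf : ContMDiffAt 𝓘(ℝ, E) 𝓘(ℝ, F) ∞ f p) {X : ∀ q : M, TangentSpace 𝓘(ℝ, E) q}
    (hX : DiffFieldAt X p) :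
    MDifferentiableAt 𝓘(ℝ, E) 𝓘(ℝ, F).tangent
      (fun q ↦ (⟨f q, mfderiv 𝓘(ℝ, E) 𝓘(ℝ, F) f q (X q)⟩ : TangentBundle 𝓘(ℝ, F) N)) p := by
  have : IsManifold 𝓘(ℝ, E) 1 M := .of_le (n := ∞) (WithTop.coe_le_coe.2 le_top)
  have : IsManifold 𝓘(ℝ, F) 1 N := .of_le (n := ∞) (WithTop.coe_le_coe.2 le_top)
  exact MDifferentiableAt.clm_apply_of_inCoordinates
    ((hf.mfderiv_const (m := ∞) le_rfl).mdifferentiableAt (by simp)) hX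
    (hf.mdifferentiableAt (by simp))

theorem contMDiffAt_mvfderiv_apply {f : M → G} {p : M}
    (hf : ContMDiffAt 𝓘(ℝ, E) 𝓘(ℝ, G) ∞ f p) {X : ∀ q : M, TangentSpace 𝓘(ℝ, E) q}
    (hX : ContMDiffAt 𝓘(ℝ, E) 𝓘(ℝ, E).tangent ∞
      (fun q ↦ (⟨q, X q⟩ : TangentBundle 𝓘(ℝ, E) M)) p) :
    ContMDiffAt 𝓘(ℝ, E) 𝓘(ℝ, G) ∞ (fun q ↦ mvfderiv 𝓘(ℝ, E) f q (X q)) p :=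
  (contMDiff_snd_tangentBundle_modelSpace G 𝓘(ℝ, G) _).comp p (contMDiffAt_mfderiv_apply hf hX)

theorem mdifferentiableAt_mvfderiv_apply {f : M → G} {p : M}
    (hf : ContMDiffAt 𝓘(ℝ, E) 𝓘(ℝ, G) ∞ f p) {X : ∀ q : M, TangentSpace 𝓘(ℝ, E) q}
    (hX : DiffFieldAt X p) :
    MDifferentiableAt 𝓘(ℝ, E) 𝓘(ℝ, G) (fun q ↦ mvfderiv 𝓘(ℝ, E) f q (X q)) p :=
  ((contMDiff_snd_tangentBundle_modelSpace G 𝓘(ℝ, G) (n := 1) _).mdifferentiableAt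
    (by simp)).comp p (mdifferentiableAt_mfderiv_apply hf hX)

theorem IsSmoothField.diffFieldAt {X : ∀ q : M, TangentSpace 𝓘(ℝ, E) q} (hX : IsSmoothField X)
    (p : M) : DiffFieldAt X p :=
  (hX p).mdifferentiableAt (by simp)

theorem diffFieldAt_extend {p : M} (v : TangentSpace 𝓘(ℝ, E) p) :
    DiffFieldAt (FiberBundle.extend E v) p := by
  have : IsManifold 𝓘(ℝ, E) 1 M := .of_le (n := ∞) (WithTop.coe_le_coe.2 le_top)
  exact FiberBundle.mdifferentiableAt_extend 𝓘(ℝ, E) E v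

/-- The local extension with constant components is cut off by a bump function equal to `1` near
`p`. -/
theorem exists_isSmoothField_eventuallyEq_extend [FiniteDimensional ℝ E] [T2Space M] {p : M}
    (v : TangentSpace 𝓘(ℝ, E) p) :
    ∃ X : ∀ q : M, TangentSpace 𝓘(ℝ, E) q, IsSmoothField X ∧
      ∀ᶠ q in 𝓝 p, X q = FiberBundle.extend E v q := by
  obtain ⟨s, hs, hv⟩ := FiberBundle.exists_contMDiffOn_extend (k := ∞) 𝓘(ℝ, E) E v
  obtain ⟨f, hf, -⟩ := (SmoothBumpFunction.nhds_basis_support (I := 𝓘(ℝ, E))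
    (interior_mem_nhds.2 hs)).mem_iff.1 (interior_mem_nhds.2 hs)
  refine ⟨(f : M → ℝ) • FiberBundle.extend E v, ?_, ?_⟩
  · exact ContMDiffOn.smul_section_of_tsupport f.contMDiff.contMDiffOn isOpen_interior hf
      (hv.mono interior_subset)
  · filter_upwards [f.eventuallyEq_one] with q hq
    simp [hq]

theorem exists_isSmoothField_eq [FiniteDimensional ℝ E] [T2Space M] {p : M}
    (v : TangentSpace 𝓘(ℝ, E) p) :
    ∃ X : ∀ q : M, TangentSpace 𝓘(ℝ, E) q, IsSmoothField X ∧ X p = v := by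
  obtain ⟨X, hX, h⟩ := exists_isSmoothField_eventuallyEq_extend v
  exact ⟨X, hX, by simpa using h.self_of_nhds⟩

end

/-! ### Fields along `ι` and their components in a chart frame. -/

section
variable {E : Type*} [NormedAddCommGroup E] [NormedSpace ℝ E]
  {M : Type*} [TopologicalSpace M] [ChartedSpace E M] [IsManifold 𝓘(ℝ, E) ∞ M]
  {F : Type*} [NormedAddCommGroup F] [NormedSpace ℝ F]
  {N : Type*} [TopologicalSpace N] [ChartedSpace F N] [IsManifold 𝓘(ℝ, F) ∞ N]
  {ι : M → N} {p : M} {W W' : ∀ p : M, TangentSpace 𝓘(ℝ, F) (ι p)}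

/-- The field `W` along `ι` is differentiable at `p`. -/
def DiffAlongAt (E : Type*) [NormedAddCommGroup E] [NormedSpace ℝ E] {M : Type*}
    [TopologicalSpace M] [ChartedSpace E M] (ι : M → N)
    (W : ∀ p : M, TangentSpace 𝓘(ℝ, F) (ι p)) (p : M) : Prop :=
  MDifferentiableAt 𝓘(ℝ, E) 𝓘(ℝ, F).tangent
    (fun q ↦ (⟨ι q, W q⟩ : TangentBundle 𝓘(ℝ, F) N)) p

/-- The field `W` along `ι` is smooth at `p`. -/
def SmoothAlongAt (E : Type*) [NormedAddCommGroup E] [NormedSpace ℝ E] {M : Type*}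
    [TopologicalSpace M] [ChartedSpace E M] (ι : M → N)
    (W : ∀ p : M, TangentSpace 𝓘(ℝ, F) (ι p)) (p : M) : Prop :=
  ContMDiffAt 𝓘(ℝ, E) 𝓘(ℝ, F).tangent ∞
    (fun q ↦ (⟨ι q, W q⟩ : TangentBundle 𝓘(ℝ, F) N)) p

/-- The coordinates of a field along `ι` in the preferred chart at `y`. -/
def coordAlong (y : N) (ι : M → N) (W : ∀ p : M, TangentSpace 𝓘(ℝ, F) (ι p)) (q : M) : F :=
  (trivializationAt F (TangentSpace 𝓘(ℝ, F) : N → Type _) y).continuousLinearMapAt ℝ (ι q) (W q)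

/-- The coordinate field with constant components `b` in the preferred chart at `y`. -/
def chartFrame (y : N) (b : F) (z : N) : TangentSpace 𝓘(ℝ, F) z :=
  (trivializationAt F (TangentSpace 𝓘(ℝ, F) : N → Type _) y).symmL ℝ z b

theorem chartFrame_add (y : N) (b c : F) :
    chartFrame y (b + c) = chartFrame y b + chartFrame y c := by
  ext z; simp [chartFrame]

theorem chartFrame_smul (y : N) (r : ℝ) (b : F) : chartFrame y (r • b) = r • chartFrame y b := by
  ext z; simp [chartFrame]

theorem chartFrame_coordAlong {y : N} {q : M} (hq : ι q ∈ (chartAt F y).source) :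
    chartFrame y (coordAlong y ι W q) (ι q) = W q :=
  Trivialization.symmL_continuousLinearMapAt _ hq _

theorem clm_chartFrame {y z : N} (hz : z ∈ (chartAt F y).source) (b : F) :
    (trivializationAt F (TangentSpace 𝓘(ℝ, F) : N → Type _) y).continuousLinearMapAt ℝ z
      (chartFrame y b z) = b :=
  Trivialization.continuousLinearMapAt_symmL _ hz _

theorem coordAlong_add (y : N) :
    coordAlong y ι (W + W') = coordAlong y ι W + coordAlong y ι W' := by
  ext q; simp [coordAlong]

theorem coordAlong_smul (y : N) (f : M → ℝ) : coordAlong y ι (f • W) = f • coordAlong y ι W := by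
  ext q; simp [coordAlong]

/-- The standard extension of a vector at `y` keeps constant components in the trivialization at
`y`, so it already is the chart frame field; only the cut-off is needed to make it global. -/
theorem exists_isSmoothField_eventuallyEq_chartFrame [FiniteDimensional ℝ F] [T2Space N]
    (y : N) (b : F) : ∃ X : ∀ z : N, TangentSpace 𝓘(ℝ, F) z, IsSmoothField X ∧
      ∀ᶠ z in 𝓝 y, X z = chartFrame y b z := by
  obtain ⟨X, hX, h⟩ := exists_isSmoothField_eventuallyEq_extend (chartFrame y b y)
  refine ⟨X, hX, ?_⟩
  set t := trivializationAt F (TangentSpace 𝓘(ℝ, F) : N → Type _) y with ht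
  have hy : y ∈ t.baseSet := FiberBundle.mem_baseSet_trivializationAt' y
  have hb := clm_chartFrame (mem_chart_source F y) b
  rw [Trivialization.continuousLinearMapAt_apply, Trivialization.coe_linearMapAt_of_mem _ hy] at hb
  filter_upwards [h, t.open_baseSet.mem_nhds hy] with z hz hzt
  rw [hz, FiberBundle.extend]
  exact (congrArg (t.symm z) hb).trans (Trivialization.symmL_apply _ hzt _).symm

theorem contMDiffAt_chartFrame {y z : N} (hz : z ∈ (chartAt F y).source) (b : F) :
    ContMDiffAt 𝓘(ℝ, F) 𝓘(ℝ, F).tangent ∞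
      (fun q ↦ (⟨q, chartFrame y b q⟩ : TangentBundle 𝓘(ℝ, F) N)) z := by
  set t := trivializationAt F (TangentSpace 𝓘(ℝ, F) : N → Type _) y with ht
  have hz' : z ∈ t.baseSet := hz
  rw [t.contMDiffAt_section_iff hz']
  have : ContMDiffAt 𝓘(ℝ, F) 𝓘(ℝ, F) ∞ (fun _ : N ↦ b) z := contMDiffAt_const
  refine this.congr_of_eventuallyEq ?_
  filter_upwards [t.open_baseSet.mem_nhds hz'] with q hq
  have := clm_chartFrame (y := y) hq b
  rwa [Trivialization.continuousLinearMapAt_apply, Trivialization.coe_linearMapAt_of_mem _ hq]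
    at this

theorem DiffAlongAt.comp {e : ∀ y : N, TangentSpace 𝓘(ℝ, F) y} (he : DiffFieldAt e (ι p))
    (hι : MDifferentiableAt 𝓘(ℝ, E) 𝓘(ℝ, F) ι p) :
    DiffAlongAt E ι (fun q ↦ e (ι q)) p :=
  MDifferentiableAt.comp p he hι

theorem SmoothAlongAt.comp {e : ∀ y : N, TangentSpace 𝓘(ℝ, F) y}
    (he : ContMDiffAt 𝓘(ℝ, F) 𝓘(ℝ, F).tangent ∞
      (fun q ↦ (⟨q, e q⟩ : TangentBundle 𝓘(ℝ, F) N)) (ι p))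
    (hι : ContMDiffAt 𝓘(ℝ, E) 𝓘(ℝ, F) ∞ ι p) :
    SmoothAlongAt E ι (fun q ↦ e (ι q)) p :=
  ContMDiffAt.comp p he hι

theorem coordAlong_eventuallyEq {y : N} (hι : ContinuousAt ι p)
    (hp : ι p ∈ (chartAt F y).source) :
    (fun q ↦ (trivializationAt F (TangentSpace 𝓘(ℝ, F) : N → Type _) y ⟨ι q, W q⟩).2) =ᶠ[𝓝 p]
      coordAlong y ι W := by
  filter_upwards [hι.eventually ((chartAt F y).open_source.mem_nhds hp)] with q hq
  rw [coordAlong, Trivialization.continuousLinearMapAt_apply,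
    Trivialization.coe_linearMapAt_of_mem _ hq]

theorem diffAlongAt_iff {y : N} (hι : MDifferentiableAt 𝓘(ℝ, E) 𝓘(ℝ, F) ι p)
    (hp : ι p ∈ (chartAt F y).source) :
    DiffAlongAt E ι W p ↔ MDifferentiableAt 𝓘(ℝ, E) 𝓘(ℝ, F) (coordAlong y ι W) p := by
  have : IsManifold 𝓘(ℝ, F) 1 N := .of_le (n := ∞) (WithTop.coe_le_coe.2 le_top)
  set t := trivializationAt F (TangentSpace 𝓘(ℝ, F) : N → Type _) y with ht
  rw [DiffAlongAt, t.mdifferentiableAt_totalSpace_iff 𝓘(ℝ, F)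
    (fun q ↦ (⟨ι q, W q⟩ : TangentBundle 𝓘(ℝ, F) N)) ((t.coe_mem_source).2 hp)]
  rw [← (coordAlong_eventuallyEq (W := W) hι.continuousAt hp).mdifferentiableAt_iff]
  exact and_iff_right hι

/-- The chart centre `y` need not be `ι p`: one fixed chart has to serve all points near a given one
when smoothness of `alongDeriv` is proved. -/
theorem smoothAlongAt_iff {y : N} (hι : ContMDiffAt 𝓘(ℝ, E) 𝓘(ℝ, F) ∞ ι p)
    (hp : ι p ∈ (chartAt F y).source) :
    SmoothAlongAt E ι W p ↔ ContMDiffAt 𝓘(ℝ, E) 𝓘(ℝ, F) ∞ (coordAlong y ι W) p := by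
  set t := trivializationAt F (TangentSpace 𝓘(ℝ, F) : N → Type _) y with ht
  rw [SmoothAlongAt, t.contMDiffAt_iff (f := fun q ↦ (⟨ι q, W q⟩ : TangentBundle 𝓘(ℝ, F) N))
    ((t.coe_mem_source).2 hp)]
  rw [← (coordAlong_eventuallyEq (W := W) hι.continuousAt hp).contMDiffAt_iff]
  exact and_iff_right hι

section
variable (hι : MDifferentiableAt 𝓘(ℝ, E) 𝓘(ℝ, F) ι p)
include hι

theorem DiffAlongAt.mdifferentiableAt_coordAlong (hW : DiffAlongAt E ι W p) :
    MDifferentiableAt 𝓘(ℝ, E) 𝓘(ℝ, F) (coordAlong (ι p) ι W) p :=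
  (diffAlongAt_iff hι (mem_chart_source F (ι p))).1 hW

theorem DiffAlongAt.add (hW : DiffAlongAt E ι W p) (hW' : DiffAlongAt E ι W' p) :
    DiffAlongAt E ι (W + W') p := by
  rw [diffAlongAt_iff hι (mem_chart_source F (ι p))] at *
  rw [coordAlong_add]
  exact hW.add hW'

theorem DiffAlongAt.smul {f : M → ℝ} (hf : MDifferentiableAt 𝓘(ℝ, E) 𝓘(ℝ, ℝ) f p)
    (hW : DiffAlongAt E ι W p) : DiffAlongAt E ι (f • W) p := by
  rw [diffAlongAt_iff hι (mem_chart_source F (ι p))] at *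
  rw [coordAlong_smul]
  exact MDifferentiableAt.smul hf hW

theorem DiffAlongAt.chartFrame (b : F) :
    DiffAlongAt E ι (fun q ↦ chartFrame (ι p) b (ι q)) p :=
  DiffAlongAt.comp ((contMDiffAt_chartFrame (mem_chart_source F (ι p)) b).mdifferentiableAt
    (by simp)) hι
end

section
variable (hι : ContMDiffAt 𝓘(ℝ, E) 𝓘(ℝ, F) ∞ ι p)
include hι

theorem SmoothAlongAt.add (hW : SmoothAlongAt E ι W p) (hW' : SmoothAlongAt E ι W' p) :
    SmoothAlongAt E ι (W + W') p := by
  rw [smoothAlongAt_iff hι (mem_chart_source F (ι p))] at *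
  rw [coordAlong_add]
  exact ContMDiffAt.add hW hW'

theorem SmoothAlongAt.smul {f : M → ℝ} (hf : ContMDiffAt 𝓘(ℝ, E) 𝓘(ℝ, ℝ) ∞ f p)
    (hW : SmoothAlongAt E ι W p) : SmoothAlongAt E ι (f • W) p := by
  rw [smoothAlongAt_iff hι (mem_chart_source F (ι p))] at *
  rw [coordAlong_smul]
  exact ContMDiffAt.smul hf hW

end

end

/-! ### Tensoriality along `ι`, and the Leibniz rule for `alongDeriv`. -/

section
variable {E : Type*} [NormedAddCommGroup E] [NormedSpace ℝ E]
  {M : Type*} [TopologicalSpace M] [ChartedSpace E M] [IsManifold 𝓘(ℝ, E) ∞ M]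
  {F : Type*} [NormedAddCommGroup F] [NormedSpace ℝ F]
  {N : Type*} [TopologicalSpace N] [ChartedSpace F N] [IsManifold 𝓘(ℝ, F) ∞ N]
  {ι : M → N} {p : M} {W W' : ∀ p : M, TangentSpace 𝓘(ℝ, F) (ι p)}
  {nabla : CovariantDerivative 𝓘(ℝ, F) F (TangentSpace 𝓘(ℝ, F) : N → Type _)}

/-- An operation on fields along `ι` that is additive and linear over functions at `p`. -/
structure TensorialAlongAt (E : Type*) [NormedAddCommGroup E] [NormedSpace ℝ E] {M : Type*}
    [TopologicalSpace M] [ChartedSpace E M] {A : Type*} [AddCommGroup A] [Module ℝ A]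
    (ι : M → N) (Φ : (∀ p : M, TangentSpace 𝓘(ℝ, F) (ι p)) → A) (p : M) : Prop where
  add : ∀ W W', DiffAlongAt E ι W p → DiffAlongAt E ι W' p → Φ (W + W') = Φ W + Φ W'
  smul : ∀ (f : M → ℝ) (W), MDifferentiableAt 𝓘(ℝ, E) 𝓘(ℝ, ℝ) f p → DiffAlongAt E ι W p →
    Φ (f • W) = f p • Φ W

theorem DiffAlongAt.zero (hι : MDifferentiableAt 𝓘(ℝ, E) 𝓘(ℝ, F) ι p) :
    DiffAlongAt E ι (0 : ∀ p : M, TangentSpace 𝓘(ℝ, F) (ι p)) p := by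
  rw [diffAlongAt_iff hι (mem_chart_source F (ι p))]
  have : coordAlong (ι p) ι (0 : ∀ p : M, TangentSpace 𝓘(ℝ, F) (ι p)) = fun _ ↦ 0 := by
    funext q; exact map_zero _
  rw [this]
  exact mdifferentiableAt_const

theorem TensorialAlongAt.sum {A : Type*} [AddCommGroup A] [Module ℝ A]
    {Φ : (∀ p : M, TangentSpace 𝓘(ℝ, F) (ι p)) → A} (hΦ : TensorialAlongAt E ι Φ p)
    (hι : MDifferentiableAt 𝓘(ℝ, E) 𝓘(ℝ, F) ι p) {κ : Type*} (s : Finset κ)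
    (V : κ → ∀ p : M, TangentSpace 𝓘(ℝ, F) (ι p)) (hV : ∀ i, DiffAlongAt E ι (V i) p) :
    DiffAlongAt E ι (∑ i ∈ s, V i) p ∧ Φ (∑ i ∈ s, V i) = ∑ i ∈ s, Φ (V i) := by
  classical
  induction s using Finset.induction_on with
  | empty =>
    refine ⟨DiffAlongAt.zero hι, ?_⟩
    have h0 : MDifferentiableAt 𝓘(ℝ, E) 𝓘(ℝ, ℝ) (fun _ : M ↦ (0 : ℝ)) p := mdifferentiableAt_const
    have h2 := hΦ.smul _ _ h0 (DiffAlongAt.zero hι)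
    rwa [smul_zero, zero_smul] at h2
  | insert a s ha h =>
    rw [Finset.sum_insert ha, Finset.sum_insert ha, hΦ.add _ _ (hV a) h.1, h.2]
    exact ⟨DiffAlongAt.add hι (hV a) h.1, rfl⟩

theorem sum_repr_chartFrame {κ : Type*} [Fintype κ] (b : Basis κ ℝ F) {y : N} {q : M}
    (hq : ι q ∈ (chartAt F y).source) :
    ∑ i, b.repr (coordAlong y ι W q) i • chartFrame y (b i) (ι q) = W q := by
  conv_rhs => rw [← chartFrame_coordAlong (W := W) hq]
  unfold chartFrame
  simp only [← map_smul, ← map_sum, b.sum_repr]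

/-- `W` is expanded in the chart frame, and the coefficient functions are pulled out of `Φ`. -/
theorem TensorialAlongAt.eq_sum [FiniteDimensional ℝ F] {A : Type*} [AddCommGroup A] [Module ℝ A]
    {Φ : (∀ p : M, TangentSpace 𝓘(ℝ, F) (ι p)) → A} (hΦ : TensorialAlongAt E ι Φ p)
    (hι : MDifferentiableAt 𝓘(ℝ, E) 𝓘(ℝ, F) ι p) (hW : DiffAlongAt E ι W p)
    {κ : Type*} [Fintype κ] (b : Basis κ ℝ F) :
    Φ W = ∑ i, b.repr (coordAlong (ι p) ι W p) i • Φ (fun q ↦ chartFrame (ι p) (b i) (ι q)) := by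
  classical
  -- The expansion of `W` holds only over the chart, while `Φ` acts on global fields. Multiplying by
  -- this indicator makes it an identity everywhere. Only differentiability at `p` is required, and
  -- the indicator is constant near `p`.
  let ψ : M → ℝ := fun q ↦ if ι q ∈ (chartAt F (ι p)).source then 1 else 0
  have hψp : ψ p = 1 := if_pos (mem_chart_source F (ι p))
  have hψ : MDifferentiableAt 𝓘(ℝ, E) 𝓘(ℝ, ℝ) ψ p := by
    have : MDifferentiableAt 𝓘(ℝ, E) 𝓘(ℝ, ℝ) (fun _ : M ↦ (1 : ℝ)) p := mdifferentiableAt_const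
    refine this.congr_of_eventuallyEq ?_
    filter_upwards [hι.continuousAt.eventually
      ((chartAt F (ι p)).open_source.mem_nhds (mem_chart_source F (ι p)))] with q hq
    exact if_pos hq
  let c : κ → M → ℝ := fun i q ↦ b.repr (coordAlong (ι p) ι W q) i
  have hc : ∀ i, MDifferentiableAt 𝓘(ℝ, E) 𝓘(ℝ, ℝ) (c i) p := fun i ↦
    ((b.coord i).toContinuousLinearMap.differentiableAt.comp_mdifferentiableAt
      (hW.mdifferentiableAt_coordAlong hι))
  have hV := fun i ↦ DiffAlongAt.chartFrame hι (b i)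
  have e : ψ • W = ∑ i, (ψ * c i) • fun q ↦ chartFrame (ι p) (b i) (ι q) := by
    funext q
    rw [Finset.sum_apply]
    simp only [Pi.smul_apply', Pi.mul_apply, mul_smul, ← Finset.smul_sum]
    by_cases hq : ι q ∈ (chartAt F (ι p)).source
    · rw [sum_repr_chartFrame b hq]
    · simp [ψ, hq]
  have h1 := hΦ.smul ψ W hψ hW
  rw [hψp, one_smul] at h1
  rw [← h1, e, (hΦ.sum hι _ _ fun i ↦ (hV i).smul hι (hψ.mul (hc i))).2]
  refine Finset.sum_congr rfl fun i _ ↦ ?_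
  rw [hΦ.smul _ _ (hψ.mul (hc i)) (hV i), Pi.mul_apply, hψp, one_mul]

/-- The frame expansion of `Φ W` involves `W` only through `W p`. -/
theorem TensorialAlongAt.congr [FiniteDimensional ℝ F] {A : Type*} [AddCommGroup A] [Module ℝ A]
    {Φ : (∀ p : M, TangentSpace 𝓘(ℝ, F) (ι p)) → A} (hΦ : TensorialAlongAt E ι Φ p)
    (hι : MDifferentiableAt 𝓘(ℝ, E) 𝓘(ℝ, F) ι p)
    (hW : DiffAlongAt E ι W p) (hW' : DiffAlongAt E ι W' p) (h : W p = W' p) : Φ W = Φ W' := by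
  rw [hΦ.eq_sum hι hW (finBasis ℝ F), hΦ.eq_sum hι hW' (finBasis ℝ F), coordAlong, coordAlong, h]

theorem alongDeriv_apply (v : TangentSpace 𝓘(ℝ, E) p) : alongDeriv ι nabla W p v =
    chartFrame (ι p) (mvfderiv 𝓘(ℝ, E) (coordAlong (ι p) ι W) p v) (ι p) +
    nabla (chartFrame (ι p) (coordAlong (ι p) ι W p)) (ι p) (mfderiv 𝓘(ℝ, E) 𝓘(ℝ, F) ι p v) := rfl

theorem alongDeriv_add (hι : MDifferentiableAt 𝓘(ℝ, E) 𝓘(ℝ, F) ι p)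
    (hW : DiffAlongAt E ι W p) (hW' : DiffAlongAt E ι W' p) :
    alongDeriv (E := E) ι nabla (W + W') p = alongDeriv ι nabla W p + alongDeriv ι nabla W' p := by
  have hc := fun b : F ↦ (contMDiffAt_chartFrame (mem_chart_source F (ι p)) b).mdifferentiableAt
    (n := ∞) (by simp)
  ext v
  simp only [alongDeriv_apply, add_apply, coordAlong_add]
  rw [mvfderiv_add (hW.mdifferentiableAt_coordAlong hι) (hW'.mdifferentiableAt_coordAlong hι)]
  rw [Pi.add_apply, chartFrame_add, nabla.isCovariantDerivativeOn.add (hc _) (hc _)]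
  simp only [add_apply, chartFrame_add, Pi.add_apply]
  abel

theorem alongDeriv_smul (hι : MDifferentiableAt 𝓘(ℝ, E) 𝓘(ℝ, F) ι p)
    {f : M → ℝ} (hf : MDifferentiableAt 𝓘(ℝ, E) 𝓘(ℝ, ℝ) f p)
    (hW : DiffAlongAt E ι W p) (v : TangentSpace 𝓘(ℝ, E) p) :
    alongDeriv ι nabla (f • W) p v =
      f p • alongDeriv ι nabla W p v + mvfderiv 𝓘(ℝ, E) f p v • W p := by
  have hc := fun b : F ↦ (contMDiffAt_chartFrame (mem_chart_source F (ι p)) b).mdifferentiableAt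
    (n := ∞) (by simp)
  simp only [alongDeriv_apply, coordAlong_smul]
  rw [mvfderiv_smul hf (hW.mdifferentiableAt_coordAlong hι)]
  rw [Pi.smul_apply', chartFrame_smul, nabla.isCovariantDerivativeOn.smul_const _ (hc _)]
  simp only [add_apply, chartFrame_add, Pi.add_apply, chartFrame_smul,
    smul_apply, ContinuousLinearMap.smulRight_apply, Pi.smul_apply,
    chartFrame_coordAlong (mem_chart_source F (ι p))]
  module

theorem alongDeriv_congr (h : ∀ᶠ q in 𝓝 p, W q = W' q) :
    alongDeriv (E := E) ι nabla W p = alongDeriv ι nabla W' p := by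
  have hc : coordAlong (ι p) ι W =ᶠ[𝓝 p] coordAlong (ι p) ι W' := by
    filter_upwards [h] with q hq
    rw [coordAlong, hq, coordAlong]
  ext v
  rw [alongDeriv_apply, alongDeriv_apply, hc.self_of_nhds, mvfderiv, mvfderiv, hc.mfderiv_eq,
    hc.self_of_nhds]

end

/-! ### Compatibility of `alongDeriv` with ambient fields, with `J` and with the metric. -/

section
variable {E : Type*} [NormedAddCommGroup E] [NormedSpace ℝ E]
  {M : Type*} [TopologicalSpace M] [ChartedSpace E M] [IsManifold 𝓘(ℝ, E) ∞ M]
  {F : Type*} [NormedAddCommGroup F] [NormedSpace ℝ F]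
  {N : Type*} [TopologicalSpace N] [ChartedSpace F N] [IsManifold 𝓘(ℝ, F) ∞ N]
  {ι : M → N} {p : M} {W W' Z : ∀ p : M, TangentSpace 𝓘(ℝ, F) (ι p)}
  {nabla : CovariantDerivative 𝓘(ℝ, F) F (TangentSpace 𝓘(ℝ, F) : N → Type _)}
  {g : ∀ x : N, TangentSpace 𝓘(ℝ, F) x →L[ℝ] TangentSpace 𝓘(ℝ, F) x →L[ℝ] ℝ} {ix : ℕ}
  {J : ∀ x : N, TangentSpace 𝓘(ℝ, F) x →L[ℝ] TangentSpace 𝓘(ℝ, F) x}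

theorem coordAlong_chartFrame_eventuallyEq (hι : ContinuousAt ι p) (b : F) :
    coordAlong (ι p) ι (fun q ↦ chartFrame (ι p) b (ι q)) =ᶠ[𝓝 p] fun _ ↦ b := by
  filter_upwards [hι.eventually
    ((chartAt F (ι p)).open_source.mem_nhds (mem_chart_source F (ι p)))] with q hq
  exact clm_chartFrame hq b

/-- The difference of the two sides is tensorial in `e`, so `e` may be replaced by a chart frame
field. Its components along `ι` are constant near `p`, and only the `nabla` term of the definition
survives. -/
theorem alongDeriv_comp [FiniteDimensional ℝ F] {e : ∀ y : N, TangentSpace 𝓘(ℝ, F) y}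
    (hι : MDifferentiableAt 𝓘(ℝ, E) 𝓘(ℝ, F) ι p) (he : DiffFieldAt e (ι p))
    (v : TangentSpace 𝓘(ℝ, E) p) :
    alongDeriv ι nabla (fun q ↦ e (ι q)) p v =
      nabla e (ι p) (mfderiv 𝓘(ℝ, E) 𝓘(ℝ, F) ι p v) := by
  have : IsManifold 𝓘(ℝ, F) 1 N := .of_le (n := ∞) (WithTop.coe_le_coe.2 le_top)
  let Φ : (∀ y : N, TangentSpace 𝓘(ℝ, F) y) → TangentSpace 𝓘(ℝ, F) (ι p) := fun e ↦
    alongDeriv ι nabla (fun q ↦ e (ι q)) p v - nabla e (ι p) (mfderiv 𝓘(ℝ, E) 𝓘(ℝ, F) ι p v)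
  have hΦ : TensorialAt 𝓘(ℝ, F) F Φ (ι p) := by
    constructor
    · intro f e hf he
      change alongDeriv ι nabla ((f ∘ ι) • fun q ↦ e (ι q)) p v - _ =
        f (ι p) • (alongDeriv ι nabla (fun q ↦ e (ι q)) p v - _)
      rw [alongDeriv_smul hι (hf.comp p hι) (DiffAlongAt.comp he hι),
        nabla.isCovariantDerivativeOn.leibniz he hf, mvfderiv_comp p hf hι]
      simp only [add_apply, smul_apply, ContinuousLinearMap.smulRight_apply,
        ContinuousLinearMap.comp_apply, Function.comp_apply]
      module
    · intro e e' he he'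
      change alongDeriv ι nabla ((fun q ↦ e (ι q)) + fun q ↦ e' (ι q)) p v - _ =
        (alongDeriv ι nabla (fun q ↦ e (ι q)) p v - _) +
        (alongDeriv ι nabla (fun q ↦ e' (ι q)) p v - _)
      rw [alongDeriv_add hι (DiffAlongAt.comp he hι) (DiffAlongAt.comp he' hι),
        nabla.isCovariantDerivativeOn.add he he']
      simp only [add_apply]
      abel
  set b := coordAlong (ι p) ι (fun q ↦ e (ι q)) p with hb
  have hc : DiffFieldAt (chartFrame (ι p) b) (ι p) :=
    (contMDiffAt_chartFrame (mem_chart_source F (ι p)) b).mdifferentiableAt (by simp)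
  have key := hΦ.pointwise he hc
    (chartFrame_coordAlong (ι := ι) (W := fun q ↦ e (ι q)) (mem_chart_source F (ι p))).symm
  have h0 : Φ (chartFrame (ι p) b) = 0 := by
    have h1 := coordAlong_chartFrame_eventuallyEq hι.continuousAt b
    change alongDeriv ι nabla _ p v - _ = 0
    have h2 : mvfderiv 𝓘(ℝ, E) (coordAlong (ι p) ι fun q ↦ chartFrame (ι p) b (ι q)) p v = 0 := by
      rw [mvfderiv, h1.mfderiv_eq, mfderiv_const]
      rfl
    rw [alongDeriv_apply, h1.self_of_nhds, h2, add_sub_cancel_right]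
    exact map_zero _
  rw [h0] at key
  exact sub_eq_zero.1 key

theorem IsPseudoMetric.mdifferentiableAt_apply (hg : IsPseudoMetric g ix)
    (hι : MDifferentiableAt 𝓘(ℝ, E) 𝓘(ℝ, F) ι p) (hW : DiffAlongAt E ι W p)
    (hZ : DiffAlongAt E ι Z p) :
    MDifferentiableAt 𝓘(ℝ, E) 𝓘(ℝ, ℝ) (fun q ↦ g (ι q) (W q) (Z q)) p := by
  have : MDifferentiableAt 𝓘(ℝ, E) (𝓘(ℝ, F).prod 𝓘(ℝ))
      (fun m ↦ TotalSpace.mk' ℝ (E := Bundle.Trivial N ℝ) (ι m) (g (ι m) (W m) (Z m))) p := by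
    apply MDifferentiableAt.clm_bundle_apply₂ (F₁ := F) (F₂ := F)
    · exact MDifferentiableAt.comp p (hg.smooth.mdifferentiableAt (by simp)) hι
    · exact hW
    · exact hZ
  simp only [mdifferentiableAt_totalSpace] at this
  exact this.2

theorem IsPseudoMetric.contMDiffAt_apply (hg : IsPseudoMetric g ix)
    (hι : ContMDiffAt 𝓘(ℝ, E) 𝓘(ℝ, F) ∞ ι p) (hW : SmoothAlongAt E ι W p)
    (hZ : SmoothAlongAt E ι Z p) :
    ContMDiffAt 𝓘(ℝ, E) 𝓘(ℝ, ℝ) ∞ (fun q ↦ g (ι q) (W q) (Z q)) p := by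
  have : ContMDiffAt 𝓘(ℝ, E) (𝓘(ℝ, F).prod 𝓘(ℝ)) ∞
      (fun m ↦ TotalSpace.mk' ℝ (E := Bundle.Trivial N ℝ) (ι m) (g (ι m) (W m) (Z m))) p := by
    apply ContMDiffAt.clm_bundle_apply₂ (F₁ := F) (F₂ := F)
    · exact ContMDiffAt.comp p hg.smooth.contMDiffAt hι
    · exact hW
    · exact hZ
  simp only [contMDiffAt_totalSpace] at this
  exact this.2

theorem IsIndefiniteKaehler.diffAlongAt_J (hK : IsIndefiniteKaehler g J nabla ix)
    (hι : MDifferentiableAt 𝓘(ℝ, E) 𝓘(ℝ, F) ι p) (hW : DiffAlongAt E ι W p) :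
    DiffAlongAt E ι (fun q ↦ J (ι q) (W q)) p := by
  apply MDifferentiableAt.clm_bundle_apply (F₁ := F) (F₂ := F)
  · exact MDifferentiableAt.comp p (hK.smooth_J.mdifferentiableAt (by simp)) hι
  · exact hW

theorem IsIndefiniteKaehler.smoothAlongAt_J (hK : IsIndefiniteKaehler g J nabla ix)
    (hι : ContMDiffAt 𝓘(ℝ, E) 𝓘(ℝ, F) ∞ ι p) (hW : SmoothAlongAt E ι W p) :
    SmoothAlongAt E ι (fun q ↦ J (ι q) (W q)) p := by
  apply ContMDiffAt.clm_bundle_apply (F₁ := F) (F₂ := F)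
  · exact ContMDiffAt.comp p hK.smooth_J.contMDiffAt hι
  · exact hW

/-- The defect is tensorial in `W`, and on a chart frame, a restricted ambient field, it vanishes by
`∇J = 0`. -/
theorem IsIndefiniteKaehler.alongDeriv_J [FiniteDimensional ℝ F]
    (hK : IsIndefiniteKaehler g J nabla ix)
    (hι : MDifferentiableAt 𝓘(ℝ, E) 𝓘(ℝ, F) ι p) (hW : DiffAlongAt E ι W p)
    (v : TangentSpace 𝓘(ℝ, E) p) :
    alongDeriv ι nabla (fun q ↦ J (ι q) (W q)) p v = J (ι p) (alongDeriv ι nabla W p v) := by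
  let Φ : (∀ p : M, TangentSpace 𝓘(ℝ, F) (ι p)) → TangentSpace 𝓘(ℝ, F) (ι p) := fun W ↦
    alongDeriv ι nabla (fun q ↦ J (ι q) (W q)) p v - J (ι p) (alongDeriv ι nabla W p v)
  have hΦ : TensorialAlongAt E ι Φ p := by
    constructor
    · intro W W' hW hW'
      have e : (fun q ↦ J (ι q) ((W + W') q)) =
          (fun q ↦ J (ι q) (W q)) + fun q ↦ J (ι q) (W' q) := by
        funext q; exact map_add _ _ _
      simp only [Φ]
      rw [e, alongDeriv_add hι (hK.diffAlongAt_J hι hW) (hK.diffAlongAt_J hι hW'),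
        alongDeriv_add hι hW hW']
      simp only [add_apply, map_add]
      abel
    · intro f W hf hW
      have e : (fun q ↦ J (ι q) ((f • W) q)) = f • (fun q ↦ J (ι q) (W q)) := by
        funext q; exact map_smul _ _ _
      simp only [Φ]
      rw [e, alongDeriv_smul hι hf (hK.diffAlongAt_J hι hW), alongDeriv_smul hι hf hW]
      simp only [map_add, map_smul]
      module
  have hb := DiffAlongAt.chartFrame hι (coordAlong (ι p) ι W p)
  have hc : DiffFieldAt (chartFrame (ι p) (coordAlong (ι p) ι W p)) (ι p) :=
    (contMDiffAt_chartFrame (mem_chart_source F (ι p)) _).mdifferentiableAt (n := ∞) (by simp)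
  have key := hΦ.congr hι hW hb (chartFrame_coordAlong (mem_chart_source F (ι p))).symm
  refine sub_eq_zero.1 (key.trans (sub_eq_zero.2 ?_))
  have hJc : DiffFieldAt (fun y ↦ J y (chartFrame (ι p) (coordAlong (ι p) ι W p) y)) (ι p) :=
    hK.diffAlongAt_J (ι := id) (p := ι p) mdifferentiableAt_id hc
  rw [alongDeriv_comp hι hc, ← hK.parallel_J _ _ hc, ← alongDeriv_comp hι hJc]

/-- The defect is tensorial in the first slot and symmetric, hence tensorial in both. Each field is
exchanged for a chart frame in turn, and metric compatibility on the ambient manifold finishes. -/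
theorem IsIndefiniteKaehler.dirDeriv_metric [FiniteDimensional ℝ F]
    (hK : IsIndefiniteKaehler g J nabla ix)
    (hι : MDifferentiableAt 𝓘(ℝ, E) 𝓘(ℝ, F) ι p) (hW : DiffAlongAt E ι W p)
    (hZ : DiffAlongAt E ι Z p) (v : TangentSpace 𝓘(ℝ, E) p) :
    dirDeriv (fun q ↦ g (ι q) (W q) (Z q)) p v =
      g (ι p) (alongDeriv ι nabla W p v) (Z p) + g (ι p) (W p) (alongDeriv ι nabla Z p v) := by
  have hg := hK.metric
  let Φ (W Z : ∀ p : M, TangentSpace 𝓘(ℝ, F) (ι p)) : ℝ :=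
    mvfderiv 𝓘(ℝ, E) (fun q ↦ g (ι q) (W q) (Z q)) p v -
      (g (ι p) (alongDeriv ι nabla W p v) (Z p) + g (ι p) (W p) (alongDeriv ι nabla Z p v))
  have hsymm : ∀ W Z, Φ W Z = Φ Z W := by
    intro W Z
    have e : (fun q ↦ g (ι q) (W q) (Z q)) = fun q ↦ g (ι q) (Z q) (W q) :=
      funext fun q ↦ hg.symm _ _ _
    simp only [Φ]
    rw [e, hg.symm _ _ (Z p), hg.symm _ (W p), add_comm (g (ι p) (Z p) _)]
  have hΦ : ∀ Z, DiffAlongAt E ι Z p → TensorialAlongAt E ι (Φ · Z) p := by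
    intro Z hZ
    constructor
    · intro W W' hW hW'
      have e : (fun q ↦ g (ι q) ((W + W') q) (Z q)) =
          (fun q ↦ g (ι q) (W q) (Z q)) + fun q ↦ g (ι q) (W' q) (Z q) := by
        funext q; simp
      simp only [Φ]
      rw [e, mvfderiv_add (hg.mdifferentiableAt_apply hι hW hZ)
        (hg.mdifferentiableAt_apply hι hW' hZ), alongDeriv_add hι hW hW']
      simp only [add_apply, map_add, Pi.add_apply]
      ring
    · intro f W hf hW
      have e : (fun q ↦ g (ι q) ((f • W) q) (Z q)) = f • fun q ↦ g (ι q) (W q) (Z q) := by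
        funext q; simp
      simp only [Φ]
      rw [e, mvfderiv_smul hf (hg.mdifferentiableAt_apply hι hW hZ), alongDeriv_smul hι hf hW]
      simp only [add_apply, map_add, map_smul, smul_apply, Pi.smul_apply', smul_eq_mul,
        ContinuousLinearMap.smulRight_apply]
      ring
  have hb := fun W ↦ DiffAlongAt.chartFrame hι (coordAlong (ι p) ι W p)
  have hc : ∀ W, DiffFieldAt (chartFrame (ι p) (coordAlong (ι p) ι W p)) (ι p) := fun W ↦
    (contMDiffAt_chartFrame (mem_chart_source F (ι p)) _).mdifferentiableAt (n := ∞) (by simp)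
  have h1 := (hΦ Z hZ).congr hι hW (hb W) (chartFrame_coordAlong (mem_chart_source F (ι p))).symm
  have h2 := (hΦ _ (hb W)).congr hι hZ (hb Z)
    (chartFrame_coordAlong (mem_chart_source F (ι p))).symm
  refine sub_eq_zero.1 ((h1.trans ((hsymm _ _).trans (h2.trans (hsymm _ _)))).trans
    (sub_eq_zero.2 ?_))
  rw [alongDeriv_comp hι (hc _), alongDeriv_comp hι (hc _)]
  have := hK.leviCivita.metric (ι p) _ _ (hc W) (hc Z) (mfderiv 𝓘(ℝ, E) 𝓘(ℝ, F) ι p v)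
  rw [covDerivTensor, dirDeriv, sub_sub, sub_eq_zero] at this
  rw [← this]
  have hgd := hg.mdifferentiableAt_apply (ι := id) (p := ι p) mdifferentiableAt_id (hc W) (hc Z)
  exact mvfderiv_comp_apply p hgd hι v

end

/-! ### Torsion and smoothness of the derivative along `ι`. -/

section
variable {E : Type*} [NormedAddCommGroup E] [NormedSpace ℝ E]
  {M : Type*} [TopologicalSpace M] [ChartedSpace E M] [IsManifold 𝓘(ℝ, E) ∞ M]
  {F : Type*} [NormedAddCommGroup F] [NormedSpace ℝ F]
  {N : Type*} [TopologicalSpace N] [ChartedSpace F N] [IsManifold 𝓘(ℝ, F) ∞ N]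
  {ι : M → N} {p : M} {W W' Z : ∀ p : M, TangentSpace 𝓘(ℝ, F) (ι p)}
  {nabla : CovariantDerivative 𝓘(ℝ, F) F (TangentSpace 𝓘(ℝ, F) : N → Type _)}
  {g : ∀ x : N, TangentSpace 𝓘(ℝ, F) x →L[ℝ] TangentSpace 𝓘(ℝ, F) x →L[ℝ] ℝ} {ix : ℕ}
  {J : ∀ x : N, TangentSpace 𝓘(ℝ, F) x →L[ℝ] TangentSpace 𝓘(ℝ, F) x}

theorem clm_eq_mvfderiv {y z : N} (hz : z ∈ (chartAt F y).source) (v : TangentSpace 𝓘(ℝ, F) z) :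
    (trivializationAt F (TangentSpace 𝓘(ℝ, F) : N → Type _) y).continuousLinearMapAt ℝ z v =
      mvfderiv 𝓘(ℝ, F) (extChartAt 𝓘(ℝ, F) y) z v := by
  have : IsManifold 𝓘(ℝ, F) 1 N := .of_le (n := ∞) (WithTop.coe_le_coe.2 le_top)
  rw [TangentBundle.continuousLinearMapAt_trivializationAt hz]
  rfl

/-- The components of `ι_* Y` become directional derivatives of one vector-valued function, the form
to which `mvfderiv_commutator` applies. -/
theorem coordAlong_push_eventuallyEq (hι : ContMDiffAt 𝓘(ℝ, E) 𝓘(ℝ, F) ∞ ι p)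
    (Y : ∀ q : M, TangentSpace 𝓘(ℝ, E) q) :
    coordAlong (ι p) ι (push ι Y) =ᶠ[𝓝 p]
      fun q ↦ mvfderiv 𝓘(ℝ, E) (extChartAt 𝓘(ℝ, F) (ι p) ∘ ι) q (Y q) := by
  have : IsManifold 𝓘(ℝ, F) 1 N := .of_le (n := ∞) (WithTop.coe_le_coe.2 le_top)
  have h2 := (contMDiffAt_iff_contMDiffAt_nhds (n := 1) (by decide)).1
    (hι.of_le (WithTop.coe_le_coe.2 le_top))
  filter_upwards [h2, hι.continuousAt.eventually
    ((chartAt F (ι p)).open_source.mem_nhds (mem_chart_source F (ι p)))] with q hq hs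
  rw [coordAlong, clm_eq_mvfderiv hs]
  exact (mfderiv_comp_apply q (mdifferentiableAt_extChartAt hs) (hq.mdifferentiableAt (by simp))
    (Y q)).symm

theorem diffAlongAt_push (hι : ContMDiffAt 𝓘(ℝ, E) 𝓘(ℝ, F) ∞ ι p)
    {Y : ∀ q : M, TangentSpace 𝓘(ℝ, E) q} (hY : DiffFieldAt Y p) :
    DiffAlongAt (F := F) E ι (push ι Y) p :=
  mdifferentiableAt_mfderiv_apply hι hY

theorem smoothAlongAt_push (hι : ContMDiffAt 𝓘(ℝ, E) 𝓘(ℝ, F) ∞ ι p)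
    {Y : ∀ q : M, TangentSpace 𝓘(ℝ, E) q} (hY : IsSmoothField Y) :
    SmoothAlongAt (F := F) E ι (push ι Y) p :=
  contMDiffAt_mfderiv_apply hι (hY p)

/-- The chart has constant derivative along each frame field near `y`. By the commutator formula its
derivative kills the bracket, whose components at `y` are therefore zero. -/
theorem mlieBracket_chartFrame [FiniteDimensional ℝ F] (y : N) (a b : F) :
    VectorField.mlieBracket 𝓘(ℝ, F) (chartFrame y a) (chartFrame y b) y = 0 := by
  have hc : ∀ b, DiffFieldAt (chartFrame y b) y := fun b ↦
    (contMDiffAt_chartFrame (mem_chart_source F y) b).mdifferentiableAt (n := ∞) (by simp)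
  have hφ : ContMDiffAt 𝓘(ℝ, F) 𝓘(ℝ, F) ∞ (extChartAt 𝓘(ℝ, F) y) y := contMDiffAt_extChartAt
  have hconst : ∀ b, (fun z ↦ mvfderiv 𝓘(ℝ, F) (extChartAt 𝓘(ℝ, F) y) z (chartFrame y b z))
      =ᶠ[𝓝 y] fun _ ↦ b := by
    intro b
    filter_upwards [(chartAt F y).open_source.mem_nhds (mem_chart_source F y)] with z hz
    rw [← clm_eq_mvfderiv hz, clm_chartFrame hz]
  have hd := fun b ↦ mdifferentiableAt_mvfderiv_apply hφ (hc b)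
  have h := mvfderiv_commutator (hφ.of_le (WithTop.coe_le_coe.2 le_top)) (hc a) (hc b) (hd a) (hd b)
  have h0 : ∀ b v, mvfderiv 𝓘(ℝ, F) (fun z ↦ mvfderiv 𝓘(ℝ, F) (extChartAt 𝓘(ℝ, F) y) z
      (chartFrame y b z)) y v = 0 := by
    intro b v
    rw [mvfderiv, (hconst b).mfderiv_eq, mfderiv_const]
    rfl
  rw [h0, h0, sub_zero, ← clm_eq_mvfderiv (mem_chart_source F y)] at h
  rw [← chartFrame_coordAlong (ι := id) (q := y) (mem_chart_source F y)
    (W := fun z ↦ VectorField.mlieBracket 𝓘(ℝ, F) (chartFrame y a) (chartFrame y b) z), coordAlong]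
  simp only [id]
  rw [← h]
  exact map_zero _

/-- The derivatives of the components produce the bracket through the commutator formula for the
chart composed with `ι`. The `nabla` terms cancel because `nabla` is torsion-free and chart frames
commute at `ι p`. -/
theorem alongDeriv_push_sub [FiniteDimensional ℝ F] [FiniteDimensional ℝ E]
    (hnabla : IsTorsionFree nabla) (hι : ContMDiffAt 𝓘(ℝ, E) 𝓘(ℝ, F) ∞ ι p)
    {X Y : ∀ q : M, TangentSpace 𝓘(ℝ, E) q} (hX : DiffFieldAt X p) (hY : DiffFieldAt Y p) :
    alongDeriv ι nabla (push ι Y) p (X p) - alongDeriv ι nabla (push ι X) p (Y p) =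
      mfderiv 𝓘(ℝ, E) 𝓘(ℝ, F) ι p (VectorField.mlieBracket 𝓘(ℝ, E) X Y p) := by
  have hp := mem_chart_source F (ι p)
  set f := extChartAt 𝓘(ℝ, F) (ι p) ∘ ι with hf
  have hfs : ContMDiffAt 𝓘(ℝ, E) 𝓘(ℝ, F) ∞ f p := contMDiffAt_extChartAt.comp p hι
  have hc : ∀ b, DiffFieldAt (chartFrame (ι p) b) (ι p) := fun b ↦
    (contMDiffAt_chartFrame hp b).mdifferentiableAt (n := ∞) (by simp)
  have hco := mvfderiv_commutator (hfs.of_le (WithTop.coe_le_coe.2 le_top)) hX hY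
    (mdifferentiableAt_mvfderiv_apply hfs hX) (mdifferentiableAt_mvfderiv_apply hfs hY)
  have hd : ∀ (Y : ∀ q : M, TangentSpace 𝓘(ℝ, E) q) v,
      mvfderiv 𝓘(ℝ, E) (coordAlong (ι p) ι (push ι Y)) p v =
      mvfderiv 𝓘(ℝ, E) (fun q ↦ mvfderiv 𝓘(ℝ, E) f q (Y q)) p v := by
    intro Y v
    have h := coordAlong_push_eventuallyEq hι Y
    rw [mvfderiv, mvfderiv, h.mfderiv_eq, h.self_of_nhds]
  have htf := hnabla (ι p) _ _ (hc (coordAlong (ι p) ι (push ι X) p))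
    (hc (coordAlong (ι p) ι (push ι Y) p))
  rw [mlieBracket_chartFrame, chartFrame_coordAlong (W := push ι X) hp,
    chartFrame_coordAlong (W := push ι Y) hp] at htf
  have hbr : coordAlong (ι p) ι (push ι (VectorField.mlieBracket 𝓘(ℝ, E) X Y)) p =
      mvfderiv 𝓘(ℝ, E) f p (VectorField.mlieBracket 𝓘(ℝ, E) X Y p) :=
    (coordAlong_push_eventuallyEq hι (VectorField.mlieBracket 𝓘(ℝ, E) X Y)).self_of_nhds
  rw [alongDeriv_apply, alongDeriv_apply, hd, hd, add_sub_add_comm]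
  refine (congrArg₂ (· + ·) ?_ htf).trans (add_zero _)
  have hs : ∀ a b : F, chartFrame (ι p) a (ι p) - chartFrame (ι p) b (ι p) =
    chartFrame (ι p) (a - b) (ι p) := fun a b ↦ (map_sub _ _ _).symm
  rw [hs, hco, ← hbr]
  exact chartFrame_coordAlong (W := push ι (VectorField.mlieBracket 𝓘(ℝ, E) X Y)) hp

theorem alongDeriv_sum (hι : MDifferentiableAt 𝓘(ℝ, E) 𝓘(ℝ, F) ι p) {κ : Type*} (s : Finset κ)
    (V : κ → ∀ p : M, TangentSpace 𝓘(ℝ, F) (ι p)) (hV : ∀ i, DiffAlongAt E ι (V i) p)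
    (v : TangentSpace 𝓘(ℝ, E) p) :
    DiffAlongAt E ι (∑ i ∈ s, V i) p ∧
      alongDeriv ι nabla (∑ i ∈ s, V i) p v = ∑ i ∈ s, alongDeriv ι nabla (V i) p v := by
  classical
  induction s using Finset.induction_on with
  | empty =>
    refine ⟨DiffAlongAt.zero hι, ?_⟩
    have h0 : MDifferentiableAt 𝓘(ℝ, E) 𝓘(ℝ, ℝ) (fun _ : M ↦ (0 : ℝ)) p := mdifferentiableAt_const
    have h2 := alongDeriv_smul (nabla := nabla) hι h0 (DiffAlongAt.zero hι) v
    rw [smul_zero] at h2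
    rw [Finset.sum_empty, Finset.sum_empty, h2]
    simp
  | insert a s ha h =>
    rw [Finset.sum_insert ha, Finset.sum_insert ha, alongDeriv_add hι (hV a) h.1, add_apply, h.2]
    exact ⟨DiffAlongAt.add hι (hV a) h.1, rfl⟩

theorem SmoothAlongAt.sum (hι : ContMDiffAt 𝓘(ℝ, E) 𝓘(ℝ, F) ∞ ι p) {κ : Type*} (s : Finset κ)
    (V : κ → ∀ p : M, TangentSpace 𝓘(ℝ, F) (ι p)) (hV : ∀ i, SmoothAlongAt E ι (V i) p) :
    SmoothAlongAt E ι (∑ i ∈ s, V i) p := by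
  classical
  induction s using Finset.induction_on with
  | empty =>
    rw [smoothAlongAt_iff hι (mem_chart_source F (ι p))]
    have : coordAlong (ι p) ι (∑ i ∈ ∅, V i) = fun _ ↦ 0 := by
      funext q; exact map_zero _
    rw [this]
    exact contMDiffAt_const
  | insert a s ha h =>
    rw [Finset.sum_insert ha]
    exact SmoothAlongAt.add hι (hV a) h

/-- The definition uses a chart that varies with the point, so smoothness cannot be read from it.
Near `p` the field is expanded as `∑ cᵢ (eᵢ ∘ ι)` with fixed ambient fields, which gives the
manifestly smooth expression `∑ (cᵢ ∇eᵢ + dcᵢ eᵢ)`. -/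
theorem smoothAlongAt_alongDeriv [FiniteDimensional ℝ F] [T2Space N]
    (hnabla : CovariantDerivative.ContMDiffCovariantDerivative nabla ∞)
    (hι : ContMDiff 𝓘(ℝ, E) 𝓘(ℝ, F) ∞ ι) (hW : ∀ q, SmoothAlongAt E ι W q)
    {X : ∀ q : M, TangentSpace 𝓘(ℝ, E) q} (hX : IsSmoothField X) :
    SmoothAlongAt E ι (fun q ↦ alongDeriv ι nabla W q (X q)) p := by
  let b := finBasis ℝ F
  have hp := mem_chart_source F (ι p)
  -- Globally smooth versions of the frame fields, so that smoothness of `nabla` can be applied to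
  -- sections over the whole manifold.
  choose e he hee using fun i ↦ exists_isSmoothField_eventuallyEq_chartFrame (ι p) (b i)
  let c : Fin (finrank ℝ F) → M → ℝ := fun i q ↦ b.repr (coordAlong (ι p) ι W q) i
  have hc : ∀ i q, ι q ∈ (chartAt F (ι p)).source →
      ContMDiffAt 𝓘(ℝ, E) 𝓘(ℝ, ℝ) ∞ (c i) q := fun i q hq ↦
    ((b.coord i).toContinuousLinearMap.contDiff.contMDiff.contMDiffAt.comp q
      ((smoothAlongAt_iff (hι q) hq).1 (hW q)))
  have hU : ∀ᶠ q in 𝓝 p, ι q ∈ (chartAt F (ι p)).source ∧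
      ∀ i, e i (ι q) = chartFrame (ι p) (b i) (ι q) := by
    have h : ∀ᶠ z in 𝓝 (ι p), z ∈ (chartAt F (ι p)).source ∧
        ∀ i, e i z = chartFrame (ι p) (b i) z :=
      Filter.Eventually.and ((chartAt F (ι p)).open_source.mem_nhds hp)
        (Filter.eventually_all.2 hee)
    exact (hι p).continuousAt.eventually h
  have hexp : ∀ᶠ q in 𝓝 p, W q = (∑ i, c i • fun q ↦ e i (ι q)) q := by
    filter_upwards [hU] with q hq
    rw [← sum_repr_chartFrame (W := W) b hq.1, Finset.sum_apply]
    refine Finset.sum_congr rfl fun i _ ↦ ?_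
    rw [Pi.smul_apply', hq.2 i]
  have hder : ∀ᶠ q in 𝓝 p, alongDeriv ι nabla W q (X q) =
      (∑ i, ((c i • fun q ↦ nabla (e i) (ι q) (push ι X q)) +
        (fun q ↦ mvfderiv 𝓘(ℝ, E) (c i) q (X q)) • fun q ↦ e i (ι q))) q := by
    filter_upwards [hexp.eventually_nhds, hU] with q hq hq2
    have hιq := (hι q).mdifferentiableAt (by simp)
    have hed := fun i ↦ DiffAlongAt.comp ((he i).diffFieldAt (ι q)) hιq
    have hcd := fun i ↦ (hc i q hq2.1).mdifferentiableAt (by simp)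
    rw [alongDeriv_congr hq, (alongDeriv_sum hιq _ _ (fun i ↦ (hed i).smul hιq (hcd i)) _).2,
      Finset.sum_apply]
    refine Finset.sum_congr rfl fun i _ ↦ ?_
    rw [alongDeriv_smul hιq (hcd i) (hed i), alongDeriv_comp hιq ((he i).diffFieldAt (ι q))]
    rfl
  refine ContMDiffAt.congr_of_eventuallyEq (SmoothAlongAt.sum (hι p) Finset.univ
    (fun i ↦ (c i • fun q ↦ nabla (e i) (ι q) (push ι X q)) +
        (fun q ↦ mvfderiv 𝓘(ℝ, E) (c i) q (X q)) • fun q ↦ e i (ι q)) fun i ↦ ?_)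
    (hder.mono fun q hq ↦ congrArg (TotalSpace.mk (ι q)) hq)
  refine SmoothAlongAt.add (hι p) (SmoothAlongAt.smul (hι p) (hc i p hp) ?_)
    (SmoothAlongAt.smul (hι p) (contMDiffAt_mvfderiv_apply (hc i p hp) (hX p))
      (SmoothAlongAt.comp (he i (ι p)) (hι p)))
  apply ContMDiffAt.clm_bundle_apply (F₁ := F) (F₂ := F)
  · have := hnabla.contMDiff.contMDiff (σ := e i) ((he i).contMDiffOn.of_le le_rfl)
    exact ContMDiffAt.comp p (contMDiffOn_univ.1 this).contMDiffAt (hι p)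
  · exact smoothAlongAt_push (hι p) hX

end

/-! ### Immersions: local left inverses and lifting of smoothness. -/

section
variable {E : Type*} [NormedAddCommGroup E] [NormedSpace ℝ E]
  {M : Type*} [TopologicalSpace M] [ChartedSpace E M] [IsManifold 𝓘(ℝ, E) ∞ M]
  {F : Type*} [NormedAddCommGroup F] [NormedSpace ℝ F]
  {N : Type*} [TopologicalSpace N] [ChartedSpace F N] [IsManifold 𝓘(ℝ, F) ∞ N]
  {ι : M → N} {p : M}

/-- In adapted charts an immersion is `x ↦ (x, 0)`; the left inverse projects to the first factor.
-/
theorem exists_leftInverse (hι : Manifold.IsImmersionAt 𝓘(ℝ, E) 𝓘(ℝ, F) ∞ ι p) :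
    ∃ r : N → M, ContMDiffAt 𝓘(ℝ, F) 𝓘(ℝ, E) ∞ r (ι p) ∧ ∀ᶠ q in 𝓝 p, r (ι q) = q := by
  obtain ⟨G, _, _, h⟩ := hι
  obtain ⟨φ, ψ, e, hpφ, hpψ, hφ, hψ, he⟩ : ∃ (φ : OpenPartialHomeomorph M E)
      (ψ : OpenPartialHomeomorph N F) (e : (E × G) ≃L[ℝ] F), p ∈ φ.source ∧ ι p ∈ ψ.source ∧
      φ ∈ IsManifold.maximalAtlas 𝓘(ℝ, E) ∞ M ∧ ψ ∈ IsManifold.maximalAtlas 𝓘(ℝ, F) ∞ N ∧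
      Set.EqOn (ψ.extend 𝓘(ℝ, F) ∘ ι ∘ (φ.extend 𝓘(ℝ, E)).symm) (e ∘ (·, 0))
        (φ.extend 𝓘(ℝ, E)).target :=
    ⟨h.domChart, h.codChart, h.equiv, h.mem_domChart_source, h.mem_codChart_source,
      h.domChart_mem_maximalAtlas, h.codChart_mem_maximalAtlas, h.writtenInCharts⟩
  have hinv : ∀ q ∈ φ.source, (e.symm (ψ.extend 𝓘(ℝ, F) (ι q))).1 = φ.extend 𝓘(ℝ, E) q := by
    intro q hq
    have hq' := he (x := φ.extend 𝓘(ℝ, E) q)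
      ((φ.extend 𝓘(ℝ, E)).map_source (by rwa [OpenPartialHomeomorph.extend_source]))
    rw [Function.comp_apply, Function.comp_apply, Function.comp_apply,
      OpenPartialHomeomorph.extend_left_inv _ hq] at hq'
    rw [hq', ContinuousLinearEquiv.symm_apply_apply]
  refine ⟨fun y ↦ (φ.extend 𝓘(ℝ, E)).symm (e.symm (ψ.extend 𝓘(ℝ, F) y)).1, ?_, ?_⟩
  · have h1 : ContMDiffAt 𝓘(ℝ, F) 𝓘(ℝ, F) ∞ (ψ.extend 𝓘(ℝ, F)) (ι p) :=
      ψ.contMDiffAt_extend hψ hpψ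
    have h2 : ContDiff ℝ ∞ fun z : F ↦ (e.symm z).1 := contDiff_fst.comp e.symm.contDiff
    have h3 := contMDiffOn_extend_symm (I := 𝓘(ℝ, E)) hφ
    have hmem : (e.symm (ψ.extend 𝓘(ℝ, F) (ι p))).1 ∈ 𝓘(ℝ, E) '' φ.target := by
      rw [hinv p hpφ]
      exact ⟨_, φ.map_source hpφ, rfl⟩
    have h4 : ContMDiffAt 𝓘(ℝ, E) 𝓘(ℝ, E) ∞ (φ.extend 𝓘(ℝ, E)).symm
        (e.symm (ψ.extend 𝓘(ℝ, F) (ι p))).1 := by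
      refine h3.contMDiffAt (IsOpen.mem_nhds ?_ hmem)
      simpa using φ.open_target
    exact ContMDiffAt.comp (ι p) (g := (φ.extend 𝓘(ℝ, E)).symm)
      (f := fun y ↦ (e.symm (ψ.extend 𝓘(ℝ, F) y)).1) h4 (h2.contMDiff.contMDiffAt.comp (ι p) h1)
  · filter_upwards [φ.open_source.mem_nhds hpφ] with q hq
    rw [hinv q hq, OpenPartialHomeomorph.extend_left_inv _ hq]

theorem mfderiv_injective (hι : Manifold.IsImmersionAt 𝓘(ℝ, E) 𝓘(ℝ, F) ∞ ι p) :
    Function.Injective (mfderiv 𝓘(ℝ, E) 𝓘(ℝ, F) ι p) := by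
  obtain ⟨r, hr, h⟩ := exists_leftInverse hι
  have hc := mfderiv_comp p (hr.mdifferentiableAt (by simp))
    (hι.contMDiffAt.mdifferentiableAt (by simp))
  have hid : mfderiv 𝓘(ℝ, E) 𝓘(ℝ, E) (r ∘ ι) p = mfderiv 𝓘(ℝ, E) 𝓘(ℝ, E) id p :=
    Filter.EventuallyEq.mfderiv_eq h
  rw [hc, mfderiv_id] at hid
  intro x y hxy
  have e : ∀ z, mfderiv 𝓘(ℝ, F) 𝓘(ℝ, E) r (ι p) (mfderiv 𝓘(ℝ, E) 𝓘(ℝ, F) ι p z) = z := fun z ↦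
    congrArg (fun L : E →L[ℝ] E ↦ L z) hid
  exact (e x).symm.trans ((congrArg _ hxy).trans (e y))

/-- Near `p` the field is recovered as `x = dr(ι_* x)` for a local left inverse `r`. Smoothness of
tangent fields can thus be checked after pushing forward, without studying how `tangentProj` varies.
-/
theorem contMDiffAt_of_push (hι : Manifold.IsImmersion 𝓘(ℝ, E) 𝓘(ℝ, F) ∞ ι)
    {x : ∀ q : M, TangentSpace 𝓘(ℝ, E) q} (hx : SmoothAlongAt (F := F) E ι (push ι x) p) :
    ContMDiffAt 𝓘(ℝ, E) 𝓘(ℝ, E).tangent ∞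
      (fun q ↦ (⟨q, x q⟩ : TangentBundle 𝓘(ℝ, E) M)) p := by
  have : IsManifold 𝓘(ℝ, E) 1 M := .of_le (n := ∞) (WithTop.coe_le_coe.2 le_top)
  have : IsManifold 𝓘(ℝ, F) 1 N := .of_le (n := ∞) (WithTop.coe_le_coe.2 le_top)
  obtain ⟨r, hr, h⟩ := exists_leftInverse (hι.isImmersionAt p)
  have hr1 := hι.contMDiff.continuous.continuousAt.eventually
    ((contMDiffAt_iff_contMDiffAt_nhds (n := 1) (by decide)).1
      (hr.of_le (WithTop.coe_le_coe.2 le_top)))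
  have hd := ContMDiffAt.comp p (hr.mfderiv_const (m := ∞) le_rfl) (hι.contMDiff p)
  have key := ContMDiffAt.clm_apply_of_inCoordinates (b₁ := ι) (b₂ := fun q ↦ r (ι q))
    (ϕ := fun q ↦ mfderiv 𝓘(ℝ, F) 𝓘(ℝ, E) r (ι q)) hd hx (hr.comp p (hι.contMDiff p))
  refine key.congr_of_eventuallyEq ?_
  filter_upwards [h.eventually_nhds, hr1] with q hq hq1
  have hc := mfderiv_comp_apply q (hq1.mdifferentiableAt (by simp))
    ((hι.contMDiff q).mdifferentiableAt (by simp)) (x q)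
  have hid : mfderiv 𝓘(ℝ, E) 𝓘(ℝ, E) (r ∘ ι) q = mfderiv 𝓘(ℝ, E) 𝓘(ℝ, E) id q :=
    Filter.EventuallyEq.mfderiv_eq hq
  have e : mfderiv 𝓘(ℝ, F) 𝓘(ℝ, E) r (ι q) (push ι x q) = x q :=
    hc.symm.trans ((congrArg (fun L : E →L[ℝ] E ↦ L (x q)) hid).trans
      (congrArg (fun L : E →L[ℝ] E ↦ L (x q)) (mfderiv_id (I := 𝓘(ℝ, E)) (x := q))))
  have h2 : ∀ (q' : M) (v : E), q' = q →
      (⟨q, v⟩ : TangentBundle 𝓘(ℝ, E) M) = ⟨q', v⟩ := by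
    rintro _ v rfl
    rfl
  exact (h2 _ (x q) hq.self_of_nhds).trans (congrArg (TotalSpace.mk (r (ι q))) e.symm)
end

/-! ### Linear algebra of the splitting `TM ⊕ tr(TM)` at a point. -/

section
variable {E : Type*} [NormedAddCommGroup E] [NormedSpace ℝ E]
  {M : Type*} [TopologicalSpace M] [ChartedSpace E M] [IsManifold 𝓘(ℝ, E) ∞ M]
  {F : Type*} [NormedAddCommGroup F] [NormedSpace ℝ F]
  {N : Type*} [TopologicalSpace N] [ChartedSpace F N] [IsManifold 𝓘(ℝ, F) ∞ N]
  {nabla : CovariantDerivative 𝓘(ℝ, F) F (TangentSpace 𝓘(ℝ, F) : N → Type _)}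
  {g : ∀ x : N, TangentSpace 𝓘(ℝ, F) x →L[ℝ] TangentSpace 𝓘(ℝ, F) x →L[ℝ] ℝ} {ix : ℕ}
  {J : ∀ x : N, TangentSpace 𝓘(ℝ, F) x →L[ℝ] TangentSpace 𝓘(ℝ, F) x}
  {ι : M → N} {ξ : ∀ p : M, TangentSpace 𝓘(ℝ, E) p}
  {S : ∀ p : M, Submodule ℝ (TangentSpace 𝓘(ℝ, E) p)}
  {n : ∀ p : M, TangentSpace 𝓘(ℝ, F) (ι p)} {p : M}

/-- A totally geodesic lightlike hypersurface of an indefinite Kähler manifold, with an adapted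
screen whose second fundamental form is symmetric. -/
structure IsGeodesicLightlike (ι : M → N)
    (g : ∀ x : N, TangentSpace 𝓘(ℝ, F) x →L[ℝ] TangentSpace 𝓘(ℝ, F) x →L[ℝ] ℝ)
    (J : ∀ x : N, TangentSpace 𝓘(ℝ, F) x →L[ℝ] TangentSpace 𝓘(ℝ, F) x)
    (nabla : CovariantDerivative 𝓘(ℝ, F) F (TangentSpace 𝓘(ℝ, F) : N → Type _)) (ix : ℕ)
    (ξ : ∀ p : M, TangentSpace 𝓘(ℝ, E) p)
    (S : ∀ p : M, Submodule ℝ (TangentSpace 𝓘(ℝ, E) p))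
    (n : ∀ p : M, TangentSpace 𝓘(ℝ, F) (ι p)) : Prop where
  finrank : finrank ℝ E + 1 = finrank ℝ F
  kaehler : IsIndefiniteKaehler g J nabla ix
  immersion : Manifold.IsImmersion 𝓘(ℝ, E) 𝓘(ℝ, F) ∞ ι
  radical : IsRadicalSection ι g ξ
  screen : IsScreen ι g ξ S n
  adapted : IsAdaptedScreen ι g J ξ S n
  geodesic : IsTotallyGeodesic ι g nabla ξ
  symmetric : IsSymmetricScreenForm ι g nabla S n

/-- `ContinuousLinearMap.inverse` is zero on maps that are not invertible. This gives it meaning in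
`tangentProj` and `sharp`, where invertibility follows from injectivity and a dimension count. -/
theorem inverse_apply_of_injective {A B : Type*} [NormedAddCommGroup A] [NormedSpace ℝ A]
    [FiniteDimensional ℝ A] [NormedAddCommGroup B] [NormedSpace ℝ B] [FiniteDimensional ℝ B]
    (f : A →L[ℝ] B) (hf : Function.Injective f) (h : Module.finrank ℝ A = Module.finrank ℝ B)
    (a : A) : f.inverse (f a) = a := by
  let e := (LinearEquiv.ofInjectiveOfFinrankEq f.toLinearMap hf h).toContinuousLinearEquiv
  have he : f = e := by ext; rfl
  rw [he, ContinuousLinearMap.inverse_equiv]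
  exact e.symm_apply_apply a

variable [FiniteDimensional ℝ E] [FiniteDimensional ℝ F]

namespace IsGeodesicLightlike

variable (h : IsGeodesicLightlike ι g J nabla ix ξ S n)
include h

theorem mdifferentiableAt (p : M) : MDifferentiableAt 𝓘(ℝ, E) 𝓘(ℝ, F) ι p :=
  (h.immersion.contMDiff p).mdifferentiableAt (by simp)

theorem injective (p : M) : Function.Injective (mfderiv 𝓘(ℝ, E) 𝓘(ℝ, F) ι p) :=
  mfderiv_injective (h.immersion.isImmersionAt p)

theorem metric_push_radical (x : TangentSpace 𝓘(ℝ, E) p) :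
    g (ι p) (mfderiv 𝓘(ℝ, E) 𝓘(ℝ, F) ι p x) (push ι ξ p) = 0 :=
  (h.kaehler.metric.symm _ _ _).trans (h.radical.radical p x)

/-- Pairing with `ξ` kills the tangent part and isolates the coefficient of `n`, since `g(n, ξ) =
1`. -/
theorem frame_injective (p : M) : Function.Injective
    ((mfderiv 𝓘(ℝ, E) 𝓘(ℝ, F) ι p).coprod (ContinuousLinearMap.toSpanSingleton ℝ (n p))) := by
  rw [injective_iff_map_eq_zero]
  rintro ⟨x, a⟩ hx
  have hx' : mfderiv 𝓘(ℝ, E) 𝓘(ℝ, F) ι p x + a • n p = 0 := hx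
  have ha := congrArg (fun v ↦ g (ι p) v (push ι ξ p)) hx'
  simp only [map_add, map_smul, add_apply, smul_apply, h.metric_push_radical, h.screen.normalized,
    map_zero, zero_apply, zero_add, smul_eq_mul, mul_one] at ha
  subst ha
  rw [zero_smul, add_zero] at hx'
  exact Prod.ext ((injective_iff_map_eq_zero _).1 (h.injective p) x hx') rfl

theorem exists_frame (v : TangentSpace 𝓘(ℝ, F) (ι p)) :
    ∃ (x : TangentSpace 𝓘(ℝ, E) p) (a : ℝ), v = mfderiv 𝓘(ℝ, E) 𝓘(ℝ, F) ι p x + a • n p := by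
  let f : (E × ℝ) →L[ℝ] F :=
    (mfderiv 𝓘(ℝ, E) 𝓘(ℝ, F) ι p).coprod (ContinuousLinearMap.toSpanSingleton ℝ (n p))
  have hs : Function.Surjective f.toLinearMap :=
    (LinearMap.injective_iff_surjective_of_finrank_eq_finrank (f := f.toLinearMap)
      (by rw [Module.finrank_prod, Module.finrank_self, h.finrank])).1 (h.frame_injective p)
  obtain ⟨⟨x, a⟩, hx⟩ := hs v
  exact ⟨x, a, hx.symm⟩

theorem tangentProj_frame (x : TangentSpace 𝓘(ℝ, E) p) (a : ℝ) :
    tangentProj ι n p (mfderiv 𝓘(ℝ, E) 𝓘(ℝ, F) ι p x + a • n p) = x :=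
  congrArg Prod.fst (inverse_apply_of_injective (A := E × ℝ) (B := F) _ (h.frame_injective p)
    (by rw [Module.finrank_prod, Module.finrank_self, h.finrank]) (x, a))

theorem tangentProj_mfderiv (x : TangentSpace 𝓘(ℝ, E) p) :
    tangentProj ι n p (mfderiv 𝓘(ℝ, E) 𝓘(ℝ, F) ι p x) = x := by
  have := h.tangentProj_frame x 0
  rwa [zero_smul, add_zero] at this

/-- The coefficient of `n` in `v` is `g(v, ξ)`. -/
theorem mfderiv_tangentProj {v : TangentSpace 𝓘(ℝ, F) (ι p)} (hv : g (ι p) v (push ι ξ p) = 0) :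
    mfderiv 𝓘(ℝ, E) 𝓘(ℝ, F) ι p (tangentProj ι n p v) = v := by
  obtain ⟨x, a, rfl⟩ := h.exists_frame v
  simp only [map_add, map_smul, add_apply, smul_apply, h.metric_push_radical, h.screen.normalized,
    zero_add, smul_eq_mul, mul_one] at hv
  subst hv
  rw [h.tangentProj_frame, zero_smul, add_zero]

/-- As `n` is null, `g(n, ·)` does not see the transversal component that the projection discards.
-/
theorem eta_tangentProj (v : TangentSpace 𝓘(ℝ, F) (ι p)) :
    eta (E := E) ι g n p (tangentProj ι n p v) = g (ι p) (n p) v := by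
  obtain ⟨x, a, rfl⟩ := h.exists_frame v
  rw [h.tangentProj_frame, map_add, map_smul, h.screen.null, smul_zero, add_zero]
  rfl

theorem eta_radical (p : M) : eta ι g n p (ξ p) = 1 := h.screen.normalized p

theorem mem_screen_iff {x : TangentSpace 𝓘(ℝ, E) p} : x ∈ S p ↔ eta ι g n p x = 0 := by
  refine ⟨h.screen.orthogonal p x, fun hx ↦ ?_⟩
  have hx' : x ∈ S p ⊔ Submodule.span ℝ {ξ p} := by
    rw [(h.screen.compl p).sup_eq_top]; trivial
  obtain ⟨s, hs, y, hy, rfl⟩ := Submodule.mem_sup.1 hx'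
  obtain ⟨c, rfl⟩ := Submodule.mem_span_singleton.1 hy
  have h0 : eta ι g n p s = 0 := h.screen.orthogonal p s hs
  rw [map_add, map_smul, h0, h.eta_radical, zero_add, smul_eq_mul, mul_one] at hx
  rwa [hx, zero_smul, add_zero]

theorem inducedMetric_symm (x y : TangentSpace 𝓘(ℝ, E) p) :
    inducedMetric ι g p x y = inducedMetric ι g p y x :=
  h.kaehler.metric.symm _ _ _

/-- `x - η(x) ξ` is orthogonal to the tangent space and to `n`, hence to everything, so
nondegeneracy of the ambient metric kills it. -/
theorem eq_smul_radical {x : TangentSpace 𝓘(ℝ, E) p} (hx : ∀ y, inducedMetric ι g p x y = 0) :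
    x = eta ι g n p x • ξ p := by
  rw [← sub_eq_zero]
  refine (injective_iff_map_eq_zero _).1 (h.injective p) _
    (h.kaehler.metric.nondegenerate _ _ fun w ↦ ?_)
  obtain ⟨y, a, rfl⟩ := h.exists_frame w
  have h1 : g (ι p) (mfderiv 𝓘(ℝ, E) 𝓘(ℝ, F) ι p (x - eta ι g n p x • ξ p))
      (mfderiv 𝓘(ℝ, E) 𝓘(ℝ, F) ι p y) = 0 := by
    change inducedMetric ι g p (x - eta ι g n p x • ξ p) y = 0
    rw [map_sub, map_smul, sub_apply, smul_apply, hx, h.radical.radical, smul_zero, sub_zero]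
  have h2 : g (ι p) (mfderiv 𝓘(ℝ, E) 𝓘(ℝ, F) ι p (x - eta ι g n p x • ξ p)) (n p) = 0 := by
    rw [h.kaehler.metric.symm]
    change eta ι g n p (x - eta ι g n p x • ξ p) = 0
    rw [map_sub, map_smul, h.eta_radical, smul_eq_mul, mul_one, sub_self]
  rw [map_add, map_smul, h1, h2, smul_zero, add_zero]

theorem exists_screen_J_radical (p : M) :
    ∃ s ∈ S p, mfderiv 𝓘(ℝ, E) 𝓘(ℝ, F) ι p s = J (ι p) (push ι ξ p) := by
  obtain ⟨D₀, hD, -⟩ := h.adapted p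
  have : J (ι p) (push ι ξ p) ∈ (S p).map (mfderiv 𝓘(ℝ, E) 𝓘(ℝ, F) ι p).toLinearMap := by
    rw [hD]
    exact Submodule.mem_sup_left (Submodule.subset_span (by simp))
  exact this

theorem exists_screen_J_transversal (p : M) :
    ∃ s ∈ S p, mfderiv 𝓘(ℝ, E) 𝓘(ℝ, F) ι p s = J (ι p) (n p) := by
  obtain ⟨D₀, hD, -⟩ := h.adapted p
  have : J (ι p) (n p) ∈ (S p).map (mfderiv 𝓘(ℝ, E) 𝓘(ℝ, F) ι p).toLinearMap := by
    rw [hD]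
    exact Submodule.mem_sup_left (Submodule.subset_span (by simp))
  exact this

theorem mfderiv_tangentProj_J_radical (p : M) :
    mfderiv 𝓘(ℝ, E) 𝓘(ℝ, F) ι p (tangentProj ι n p (-J (ι p) (push ι ξ p))) =
      -J (ι p) (push ι ξ p) := by
  obtain ⟨s, -, hs⟩ := h.exists_screen_J_radical p
  rw [← hs, ← map_neg, h.tangentProj_mfderiv]

theorem mfderiv_tangentProj_J_transversal (p : M) :
    mfderiv 𝓘(ℝ, E) 𝓘(ℝ, F) ι p (tangentProj ι n p (J (ι p) (n p))) = J (ι p) (n p) := by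
  obtain ⟨s, -, hs⟩ := h.exists_screen_J_transversal p
  rw [← hs, h.tangentProj_mfderiv]

theorem metric_transversal_J_radical (p : M) : g (ι p) (n p) (J (ι p) (push ι ξ p)) = 0 := by
  obtain ⟨s, hs, e⟩ := h.exists_screen_J_radical p
  rw [← e]
  exact h.screen.orthogonal p s hs

theorem metric_J_radical (x : TangentSpace 𝓘(ℝ, E) p) :
    inducedMetric ι g p (tangentProj ι n p (-J (ι p) (push ι ξ p))) x = theta₀ ι g J ξ p x :=
  congrArg (fun v ↦ g (ι p) v (mfderiv 𝓘(ℝ, E) 𝓘(ℝ, F) ι p x)) (h.mfderiv_tangentProj_J_radical p)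

theorem eta_J_radical (p : M) :
    eta (E := E) ι g n p (tangentProj ι n p (-J (ι p) (push ι ξ p))) = 0 := by
  rw [h.eta_tangentProj, map_neg, h.metric_transversal_J_radical, neg_zero]

theorem theta₀_radical (p : M) : theta₀ ι g J ξ p (ξ p) = 0 := by
  rw [← h.metric_J_radical, h.inducedMetric_symm, h.radical.radical]

/-- By the Hermitian property `g(-Jξ, Jn) = -g(ξ, n)`. This value shows that `θ₀` and `g₀` vanish
nowhere. -/
theorem theta₀_J_transversal (p : M) :
    theta₀ ι g J ξ p (tangentProj ι n p (J (ι p) (n p))) = -1 := by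
  refine (congrArg (g (ι p) (-J (ι p) (push ι ξ p)))
    (h.mfderiv_tangentProj_J_transversal p)).trans ?_
  rw [map_neg, neg_apply, h.kaehler.hermitian, h.kaehler.metric.symm, h.screen.normalized]

theorem flat_injective (p : M) : Function.Injective (flat (E := E) ι g n p) := by
  rw [injective_iff_map_eq_zero]
  intro x hx
  have hx' : ∀ y, inducedMetric ι g p x y + eta ι g n p x * eta ι g n p y = 0 := fun y ↦
    congrArg (fun L : TangentSpace 𝓘(ℝ, E) p →L[ℝ] ℝ ↦ L y) hx
  have h0 : eta ι g n p x = 0 := by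
    have := hx' (ξ p)
    rwa [h.inducedMetric_symm, h.radical.radical, zero_add, h.eta_radical, mul_one] at this
  have h1 := h.eq_smul_radical (x := x) fun y ↦ by
    have := hx' y
    rwa [h0, zero_mul, add_zero] at this
  rw [h1, h0, zero_smul]

/-- Since `-Jξ` lies in the screen, its `η`-term in `flat` drops out. -/
theorem sharp_theta₀ (p : M) :
    sharp ι g n (theta₀ ι g J ξ) p = tangentProj ι n p (-J (ι p) (push ι ξ p)) := by
  have e : theta₀ ι g J ξ p = flat ι g n p (tangentProj ι n p (-J (ι p) (push ι ξ p))) := by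
    ext y
    change _ = inducedMetric ι g p _ y + eta ι g n p _ * eta ι g n p y
    rw [h.eta_J_radical, zero_mul, add_zero, h.metric_J_radical]
  have hfr : Module.finrank ℝ E = Module.finrank ℝ (E →L[ℝ] ℝ) := by
    rw [← (LinearMap.toContinuousLinearMap (𝕜 := ℝ) (E := E) (F' := ℝ)).finrank_eq]
    exact (Subspace.dual_finrank_eq (K := ℝ) (V := E)).symm
  rw [sharp, e]
  exact inverse_apply_of_injective (A := E) (B := E →L[ℝ] ℝ) _ (h.flat_injective p) hfr _

end IsGeodesicLightlike
end

/-! ### The induced connection and the second fundamental form of the screen. -/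

section
variable {E : Type*} [NormedAddCommGroup E] [NormedSpace ℝ E]
  {M : Type*} [TopologicalSpace M] [ChartedSpace E M] [IsManifold 𝓘(ℝ, E) ∞ M]
  {F : Type*} [NormedAddCommGroup F] [NormedSpace ℝ F]
  {N : Type*} [TopologicalSpace N] [ChartedSpace F N] [IsManifold 𝓘(ℝ, F) ∞ N]
  {nabla : CovariantDerivative 𝓘(ℝ, F) F (TangentSpace 𝓘(ℝ, F) : N → Type _)}
  {g : ∀ x : N, TangentSpace 𝓘(ℝ, F) x →L[ℝ] TangentSpace 𝓘(ℝ, F) x →L[ℝ] ℝ} {ix : ℕ}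
  {J : ∀ x : N, TangentSpace 𝓘(ℝ, F) x →L[ℝ] TangentSpace 𝓘(ℝ, F) x}
  {ι : M → N} {ξ : ∀ p : M, TangentSpace 𝓘(ℝ, E) p}
  {S : ∀ p : M, Submodule ℝ (TangentSpace 𝓘(ℝ, E) p)}
  {n : ∀ p : M, TangentSpace 𝓘(ℝ, F) (ι p)} {p : M}
variable [FiniteDimensional ℝ E] [FiniteDimensional ℝ F]

/-- The bilinear form `(X, Y) ↦ -g(∇_X N, P Y)`, whose restriction to the screen is the second
fundamental form `C`. -/
def transversalForm (ι : M → N)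
    (g : ∀ x : N, TangentSpace 𝓘(ℝ, F) x →L[ℝ] TangentSpace 𝓘(ℝ, F) x →L[ℝ] ℝ)
    (nabla : CovariantDerivative 𝓘(ℝ, F) F (TangentSpace 𝓘(ℝ, F) : N → Type _))
    (ξ : ∀ p : M, TangentSpace 𝓘(ℝ, E) p) (n : ∀ p : M, TangentSpace 𝓘(ℝ, F) (ι p)) (p : M) :
    TangentSpace 𝓘(ℝ, E) p →L[ℝ] TangentSpace 𝓘(ℝ, E) p →L[ℝ] ℝ :=
  -(((mfderiv 𝓘(ℝ, E) 𝓘(ℝ, F) ι p).comp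
      (ContinuousLinearMap.id ℝ _ - (eta ι g n p).smulRight (ξ p))).precomp ℝ).comp
    ((g (ι p)).comp (alongDeriv ι nabla n p))

theorem transversalForm_apply (x y : TangentSpace 𝓘(ℝ, E) p) :
    transversalForm ι g nabla ξ n p x y =
      -g (ι p) (alongDeriv ι nabla n p x)
        (mfderiv 𝓘(ℝ, E) 𝓘(ℝ, F) ι p (y - eta ι g n p y • ξ p)) := rfl

theorem DiffFieldAt.add {X Y : ∀ q : M, TangentSpace 𝓘(ℝ, E) q} (hX : DiffFieldAt X p)
    (hY : DiffFieldAt Y p) : DiffFieldAt (X + Y) p :=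
  DiffAlongAt.add (ι := id) mdifferentiableAt_id hX hY

theorem DiffFieldAt.smul {f : M → ℝ} {Y : ∀ q : M, TangentSpace 𝓘(ℝ, E) q}
    (hf : MDifferentiableAt 𝓘(ℝ, E) 𝓘(ℝ, ℝ) f p) (hY : DiffFieldAt Y p) : DiffFieldAt (f • Y) p :=
  DiffAlongAt.smul (ι := id) mdifferentiableAt_id hf hY

theorem IsSmoothField.add {X Y : ∀ q : M, TangentSpace 𝓘(ℝ, E) q} (hX : IsSmoothField X)
    (hY : IsSmoothField Y) : IsSmoothField (X + Y) := fun p ↦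
  SmoothAlongAt.add (ι := id) contMDiffAt_id (hX p) (hY p)

theorem IsSmoothField.smul {f : M → ℝ} {Y : ∀ q : M, TangentSpace 𝓘(ℝ, E) q}
    (hf : ContMDiff 𝓘(ℝ, E) 𝓘(ℝ, ℝ) ∞ f) (hY : IsSmoothField Y) : IsSmoothField (f • Y) := fun p ↦
  SmoothAlongAt.smul (ι := id) contMDiffAt_id (hf p) (hY p)

namespace IsGeodesicLightlike

variable (h : IsGeodesicLightlike ι g J nabla ix ξ S n)
  {X Y Z : ∀ q : M, TangentSpace 𝓘(ℝ, E) q}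
include h

theorem diffAlongAt_push (hY : DiffFieldAt Y p) : DiffAlongAt (F := F) E ι (push ι Y) p :=
  LightlikeGeometry.diffAlongAt_push (h.immersion.contMDiff p) hY

theorem diffAlongAt_transversal (p : M) : DiffAlongAt E ι n p :=
  (h.screen.smooth p).mdifferentiableAt (by simp)

/-- `B = 0` leaves no transversal term in the Gauss formula, so identities for the ambient
derivative pull back unchanged. -/
theorem mfderiv_inducedConnection (hY : DiffFieldAt Y p) (x : TangentSpace 𝓘(ℝ, E) p) :
    mfderiv 𝓘(ℝ, E) 𝓘(ℝ, F) ι p (inducedConnection ι nabla n Y p x) =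
      alongDeriv ι nabla (push ι Y) p x :=
  h.mfderiv_tangentProj (h.geodesic p Y hY x)

theorem inducedConnection_add (hY : DiffFieldAt Y p) (hZ : DiffFieldAt Z p) :
    inducedConnection ι nabla n (Y + Z) p =
      inducedConnection ι nabla n Y p + inducedConnection ι nabla n Z p := by
  have e : push (F := F) ι (Y + Z) = push ι Y + push ι Z := by
    funext q; exact map_add _ _ _
  rw [inducedConnection, e, alongDeriv_add (h.mdifferentiableAt p) (h.diffAlongAt_push hY)
    (h.diffAlongAt_push hZ), ContinuousLinearMap.comp_add]
  rfl

theorem inducedConnection_smul {f : M → ℝ} (hf : MDifferentiableAt 𝓘(ℝ, E) 𝓘(ℝ, ℝ) f p)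
    (hY : DiffFieldAt Y p) (x : TangentSpace 𝓘(ℝ, E) p) :
    inducedConnection ι nabla n (f • Y) p x =
      f p • inducedConnection ι nabla n Y p x + mvfderiv 𝓘(ℝ, E) f p x • Y p := by
  have e : push (F := F) ι (f • Y) = f • push ι Y := by
    funext q; exact map_smul _ _ _
  change tangentProj ι n p (alongDeriv ι nabla (push ι (f • Y)) p x) = _
  rw [e, alongDeriv_smul (h.mdifferentiableAt p) hf (h.diffAlongAt_push hY), map_add, map_smul,
    map_smul]
  congr 2
  exact h.tangentProj_mfderiv (Y p)

theorem inducedConnection_sub (hX : DiffFieldAt X p) (hY : DiffFieldAt Y p) :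
    inducedConnection ι nabla n Y p (X p) - inducedConnection ι nabla n X p (Y p) =
      VectorField.mlieBracket 𝓘(ℝ, E) X Y p := by
  apply h.injective p
  rw [map_sub, h.mfderiv_inducedConnection hY, h.mfderiv_inducedConnection hX,
    alongDeriv_push_sub h.kaehler.leviCivita.torsionFree (h.immersion.contMDiff p) hX hY]

theorem dirDeriv_inducedMetric (hY : DiffFieldAt Y p) (hZ : DiffFieldAt Z p)
    (x : TangentSpace 𝓘(ℝ, E) p) :
    dirDeriv (fun q ↦ inducedMetric ι g q (Y q) (Z q)) p x =
      inducedMetric ι g p (inducedConnection ι nabla n Y p x) (Z p) +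
        inducedMetric ι g p (Y p) (inducedConnection ι nabla n Z p x) := by
  refine (h.kaehler.dirDeriv_metric (h.mdifferentiableAt p) (h.diffAlongAt_push hY)
    (h.diffAlongAt_push hZ) x).trans ?_
  rw [← h.mfderiv_inducedConnection hY, ← h.mfderiv_inducedConnection hZ]
  rfl

/-- Differentiate `g₀(ξ, Y) = 0`; the term `g₀(ξ, D_x Y)` vanishes because `ξ` is radical. -/
theorem inducedMetric_inducedConnection_radical (x y : TangentSpace 𝓘(ℝ, E) p) :
    inducedMetric ι g p (inducedConnection ι nabla n ξ p x) y = 0 := by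
  have hy : DiffFieldAt (FiberBundle.extend E y) p := diffFieldAt_extend y
  have := h.dirDeriv_inducedMetric (h.radical.smooth.diffFieldAt p) hy x
  have e : (fun q ↦ inducedMetric ι g q (ξ q) (FiberBundle.extend E y q)) = fun _ ↦ 0 :=
    funext fun q ↦ h.radical.radical q _
  rw [e, h.radical.radical, add_zero, FiberBundle.extend_apply_self, dirDeriv, mvfderiv,
    mfderiv_const] at this
  exact this.symm

theorem inducedConnection_radical (x : TangentSpace 𝓘(ℝ, E) p) :
    inducedConnection ι nabla n ξ p x = phi ι g nabla ξ n p x • ξ p :=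
  h.eq_smul_radical (h.inducedMetric_inducedConnection_radical x)

theorem mdifferentiableAt_eta (hY : DiffFieldAt Y p) :
    MDifferentiableAt 𝓘(ℝ, E) 𝓘(ℝ, ℝ) (fun q ↦ eta ι g n q (Y q)) p :=
  h.kaehler.metric.mdifferentiableAt_apply (h.mdifferentiableAt p) (h.diffAlongAt_transversal p)
    (h.diffAlongAt_push hY)

theorem screenProj_eq (Y : ∀ q : M, TangentSpace 𝓘(ℝ, E) q) :
    screenProj ι g ξ n Y = Y + (fun q ↦ -eta ι g n q (Y q)) • ξ := by
  funext q
  rw [screenProj, sub_eq_add_neg, ← neg_smul]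
  rfl

theorem diffFieldAt_screenProj (hY : DiffFieldAt Y p) : DiffFieldAt (screenProj ι g ξ n Y) p := by
  rw [h.screenProj_eq]
  exact hY.add (DiffFieldAt.smul (h.mdifferentiableAt_eta hY).neg (h.radical.smooth.diffFieldAt p))

theorem eta_screenProj (Y : ∀ q : M, TangentSpace 𝓘(ℝ, E) q) (q : M) :
    eta ι g n q (screenProj ι g ξ n Y q) = 0 := by
  rw [screenProj, map_sub, map_smul, h.eta_radical, smul_eq_mul, mul_one, sub_self]

/-- Differentiating `g(n, PY) = 0` moves the derivative from `PY` to `n`, so `C(x, PY)` depends on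
`Y` only through its value at `p`. -/
theorem screenForm_screenProj (hY : DiffFieldAt Y p) (x : TangentSpace 𝓘(ℝ, E) p) :
    screenForm ι g nabla n p x (screenProj ι g ξ n Y) =
      transversalForm ι g nabla ξ n p x (Y p) := by
  have hP := h.diffFieldAt_screenProj hY
  have h1 : eta ι g n p (inducedConnection ι nabla n (screenProj ι g ξ n Y) p x) =
      g (ι p) (n p) (alongDeriv ι nabla (push ι (screenProj ι g ξ n Y)) p x) :=
    h.eta_tangentProj _
  have h2 := h.kaehler.dirDeriv_metric (h.mdifferentiableAt p) (h.diffAlongAt_transversal p)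
    (h.diffAlongAt_push hP) x
  have e : (fun q ↦ g (ι q) (n q) (push ι (screenProj ι g ξ n Y) q)) = fun _ ↦ 0 :=
    funext fun q ↦ h.eta_screenProj Y q
  have h3 : dirDeriv (E := E) (fun _ : M ↦ (0 : ℝ)) p x = 0 := by
    rw [dirDeriv, mvfderiv, mfderiv_const]; rfl
  rw [e, h3] at h2
  rw [screenForm, h1]
  exact eq_neg_of_add_eq_zero_right h2.symm

theorem transversalForm_radical (x : TangentSpace 𝓘(ℝ, E) p) :
    transversalForm ι g nabla ξ n p x (ξ p) = 0 := by
  rw [transversalForm_apply, h.eta_radical, one_smul, sub_self, map_zero, map_zero, neg_zero]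

theorem transversalForm_screen_symm (x y : TangentSpace 𝓘(ℝ, E) p) :
    transversalForm ι g nabla ξ n p (x - eta ι g n p x • ξ p) y =
      transversalForm ι g nabla ξ n p (y - eta ι g n p y • ξ p) x := by
  have hx : DiffFieldAt (FiberBundle.extend E x) p := diffFieldAt_extend x
  have hy : DiffFieldAt (FiberBundle.extend E y) p := diffFieldAt_extend y
  have := h.symmetric p _ _ (h.diffFieldAt_screenProj hx) (h.diffFieldAt_screenProj hy)
    (fun q ↦ h.mem_screen_iff.2 (h.eta_screenProj _ q))
    (fun q ↦ h.mem_screen_iff.2 (h.eta_screenProj _ q))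
  rw [h.screenForm_screenProj hy, h.screenForm_screenProj hx, screenProj, screenProj,
    FiberBundle.extend_apply_self, FiberBundle.extend_apply_self] at this
  exact this

/-- Symmetry on the screen, expanded with `Px = x - η(x) ξ`. This is precisely the part of the
symmetry of `S` that involves `C`. -/
theorem transversalForm_add_symm (x y : TangentSpace 𝓘(ℝ, E) p) :
    transversalForm ι g nabla ξ n p x y +
        eta ι g n p y * transversalForm ι g nabla ξ n p (ξ p) x =
      transversalForm ι g nabla ξ n p y x +
        eta ι g n p x * transversalForm ι g nabla ξ n p (ξ p) y := by
  have := h.transversalForm_screen_symm x y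
  simp only [map_sub, map_smul, sub_apply, smul_apply, smul_eq_mul] at this
  linarith

end IsGeodesicLightlike
end

/-! ### The connection `D^J` as a tensorial correction of `D^{g₀}`, and the exterior derivative of
`θ₀`. -/

section
variable {E : Type*} [NormedAddCommGroup E] [NormedSpace ℝ E]
  {M : Type*} [TopologicalSpace M] [ChartedSpace E M] [IsManifold 𝓘(ℝ, E) ∞ M]
  {F : Type*} [NormedAddCommGroup F] [NormedSpace ℝ F]
  {N : Type*} [TopologicalSpace N] [ChartedSpace F N] [IsManifold 𝓘(ℝ, F) ∞ N]
  {nabla : CovariantDerivative 𝓘(ℝ, F) F (TangentSpace 𝓘(ℝ, F) : N → Type _)}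
  {g : ∀ x : N, TangentSpace 𝓘(ℝ, F) x →L[ℝ] TangentSpace 𝓘(ℝ, F) x →L[ℝ] ℝ} {ix : ℕ}
  {J : ∀ x : N, TangentSpace 𝓘(ℝ, F) x →L[ℝ] TangentSpace 𝓘(ℝ, F) x}
  {ι : M → N} {ξ : ∀ p : M, TangentSpace 𝓘(ℝ, E) p}
  {S : ∀ p : M, Submodule ℝ (TangentSpace 𝓘(ℝ, E) p)}
  {n : ∀ p : M, TangentSpace 𝓘(ℝ, F) (ι p)} {p : M}
variable [FiniteDimensional ℝ E] [FiniteDimensional ℝ F]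

/-- The symmetric form `S` as a field of bilinear forms. -/
def correctionBilin (ι : M → N)
    (g : ∀ x : N, TangentSpace 𝓘(ℝ, F) x →L[ℝ] TangentSpace 𝓘(ℝ, F) x →L[ℝ] ℝ)
    (J : ∀ x : N, TangentSpace 𝓘(ℝ, F) x →L[ℝ] TangentSpace 𝓘(ℝ, F) x)
    (nabla : CovariantDerivative 𝓘(ℝ, F) F (TangentSpace 𝓘(ℝ, F) : N → Type _))
    (ξ : ∀ p : M, TangentSpace 𝓘(ℝ, E) p) (n : ∀ p : M, TangentSpace 𝓘(ℝ, F) (ι p)) (p : M) :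
    TangentSpace 𝓘(ℝ, E) p →L[ℝ] TangentSpace 𝓘(ℝ, E) p →L[ℝ] ℝ :=
  transversalForm ι g nabla ξ n p + (eta ι g n p).smulRight (theta₀ ι g J ξ p) +
    ((transversalForm ι g nabla ξ n p (ξ p)) + theta₀ ι g J ξ p).smulRight (eta ι g n p)

theorem correctionBilin_apply (x y : TangentSpace 𝓘(ℝ, E) p) :
    correctionBilin ι g J nabla ξ n p x y =
      transversalForm ι g nabla ξ n p x y + eta ι g n p x * theta₀ ι g J ξ p y +
        (transversalForm ι g nabla ξ n p (ξ p) x + theta₀ ι g J ξ p x) * eta ι g n p y := rfl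

/-- The vector field `V` with `ι_* V = -J ξ`. -/
def radicalDual (ι : M → N) (J : ∀ x : N, TangentSpace 𝓘(ℝ, F) x →L[ℝ] TangentSpace 𝓘(ℝ, F) x)
    (ξ : ∀ p : M, TangentSpace 𝓘(ℝ, E) p) (n : ∀ p : M, TangentSpace 𝓘(ℝ, F) (ι p)) (p : M) :
    TangentSpace 𝓘(ℝ, E) p :=
  tangentProj ι n p (-J (ι p) (push ι ξ p))

/-- The vector field `U` with `ι_* U = J n`. -/
def transversalDual (ι : M → N)
    (J : ∀ x : N, TangentSpace 𝓘(ℝ, F) x →L[ℝ] TangentSpace 𝓘(ℝ, F) x)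
    (n : ∀ p : M, TangentSpace 𝓘(ℝ, F) (ι p)) (p : M) : TangentSpace 𝓘(ℝ, E) p :=
  tangentProj ι n p (J (ι p) (n p))

/-- The Weyl connection `D^J`, as an operation on vector fields. -/
def weylDeriv (ι : M → N)
    (g : ∀ x : N, TangentSpace 𝓘(ℝ, F) x →L[ℝ] TangentSpace 𝓘(ℝ, F) x →L[ℝ] ℝ)
    (J : ∀ x : N, TangentSpace 𝓘(ℝ, F) x →L[ℝ] TangentSpace 𝓘(ℝ, F) x)
    (nabla : CovariantDerivative 𝓘(ℝ, F) F (TangentSpace 𝓘(ℝ, F) : N → Type _))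
    (ξ : ∀ p : M, TangentSpace 𝓘(ℝ, E) p) (n : ∀ p : M, TangentSpace 𝓘(ℝ, F) (ι p))
    (Y : ∀ q : M, TangentSpace 𝓘(ℝ, E) q) (p : M) :
    TangentSpace 𝓘(ℝ, E) p →L[ℝ] TangentSpace 𝓘(ℝ, E) p :=
  inducedConnection ι nabla n Y p + (theta₀ ι g J ξ p).smulRight (Y p) +
    theta₀ ι g J ξ p (Y p) • ContinuousLinearMap.id ℝ (TangentSpace 𝓘(ℝ, E) p) -
    (inducedMetric ι g p (Y p)).smulRight (radicalDual ι J ξ n p) -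
    (correctionBilin ι g J nabla ξ n p (Y p)).smulRight (ξ p)

theorem weylDeriv_apply (Y : ∀ q : M, TangentSpace 𝓘(ℝ, E) q) (x : TangentSpace 𝓘(ℝ, E) p) :
    weylDeriv ι g J nabla ξ n Y p x =
      inducedConnection ι nabla n Y p x + theta₀ ι g J ξ p x • Y p + theta₀ ι g J ξ p (Y p) • x -
        inducedMetric ι g p (Y p) x • radicalDual ι J ξ n p -
        correctionBilin ι g J nabla ξ n p (Y p) x • ξ p := rfl

theorem dirDeriv_const (c : ℝ) (x : TangentSpace 𝓘(ℝ, E) p) :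
    dirDeriv (fun _ : M ↦ c) p x = 0 := by
  rw [dirDeriv, mvfderiv, mfderiv_const]; rfl

theorem dirDeriv_smul {f k : M → ℝ} (hf : MDifferentiableAt 𝓘(ℝ, E) 𝓘(ℝ, ℝ) f p)
    (hk : MDifferentiableAt 𝓘(ℝ, E) 𝓘(ℝ, ℝ) k p) (x : TangentSpace 𝓘(ℝ, E) p) :
    dirDeriv (fun q ↦ f q * k q) p x = f p * dirDeriv k p x + dirDeriv f p x * k p := by
  change mvfderiv 𝓘(ℝ, E) (f • k) p x = _
  rw [mvfderiv_smul hf hk]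
  rfl

theorem dirDeriv_exp {f : M → ℝ} (hf : MDifferentiableAt 𝓘(ℝ, E) 𝓘(ℝ, ℝ) f p)
    (x : TangentSpace 𝓘(ℝ, E) p) :
    dirDeriv (fun q ↦ Real.exp (-2 * f q)) p x = Real.exp (-2 * f p) * (-2 * dirDeriv f p x) := by
  have h1 : HasDerivAt (fun t : ℝ ↦ Real.exp (-2 * t)) (Real.exp (-2 * f p) * (-2)) (f p) := by
    simpa using ((hasDerivAt_id (f p)).const_mul (-2 : ℝ)).exp
  have h2 := mvfderiv_comp_apply (g := fun t : ℝ ↦ Real.exp (-2 * t)) p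
    h1.differentiableAt.mdifferentiableAt hf x
  refine h2.trans ?_
  have h3 : mvfderiv 𝓘(ℝ, ℝ) (fun t : ℝ ↦ Real.exp (-2 * t)) (f p) =
      fderiv ℝ (fun t : ℝ ↦ Real.exp (-2 * t)) (f p) := by
    rw [mvfderiv, mfderiv_eq_fderiv]; rfl
  rw [h3, h1.hasFDerivAt.fderiv]
  change dirDeriv f p x * (Real.exp (-2 * f p) * (-2)) = _
  ring

namespace IsGeodesicLightlike

variable (h : IsGeodesicLightlike ι g J nabla ix ξ S n)
  {X Y Z : ∀ q : M, TangentSpace 𝓘(ℝ, E) q}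
include h

theorem correctionBilin_symm (x y : TangentSpace 𝓘(ℝ, E) p) :
    correctionBilin ι g J nabla ξ n p x y = correctionBilin ι g J nabla ξ n p y x := by
  have := h.transversalForm_add_symm x y
  rw [correctionBilin_apply, correctionBilin_apply]
  linarith

theorem correctionForm_eq (hX : DiffFieldAt X p) (hY : DiffFieldAt Y p) :
    correctionForm ι g nabla ξ n (theta₀ ι g J ξ) X Y p =
      correctionBilin ι g J nabla ξ n p (X p) (Y p) := by
  rw [correctionForm, h.screenForm_screenProj hX, h.screenForm_screenProj hY, screenProj,
    screenProj, map_sub, map_sub, map_smul, map_smul, h.theta₀_radical, smul_zero, smul_zero,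
    sub_zero, sub_zero, correctionBilin_apply]
  ring

/-- Only the `D^{g₀}` term differentiates `Y`; every other term is linear over functions in `Y`. -/
theorem isCovariantDerivativeOn_weylDeriv :
    IsCovariantDerivativeOn E (V := (TangentSpace 𝓘(ℝ, E) : M → Type _))
      (weylDeriv ι g J nabla ξ n) Set.univ where
  add {Y Z p} hY hZ _ := by
    ext x
    rw [add_apply, weylDeriv_apply, weylDeriv_apply, weylDeriv_apply,
      h.inducedConnection_add hY hZ]
    simp only [Pi.add_apply, add_apply, map_add]
    module
  leibniz {Y f p} hY hf _ := by
    ext x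
    rw [add_apply, smul_apply, weylDeriv_apply, weylDeriv_apply, h.inducedConnection_smul hf hY]
    simp only [Pi.smul_apply', map_smul, ContinuousLinearMap.smulRight_apply, smul_eq_mul,
      smul_apply]
    module

theorem exists_hasScreenData :
    ∃ D : CovariantDerivative 𝓘(ℝ, E) E (TangentSpace 𝓘(ℝ, E) : M → Type _),
      HasScreenData ι g nabla ξ n (theta₀ ι g J ξ) D :=
  ⟨⟨weylDeriv ι g J nabla ξ n, h.isCovariantDerivativeOn_weylDeriv⟩, fun p X Y hX hY ↦ by
    -- `weylDeriv` feeds `Y p` first into both bilinear forms, to be a linear map in the direction;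
    -- symmetry restores the order of the stated formula.
    rw [h.correctionForm_eq hX hY, h.sharp_theta₀, h.inducedMetric_symm, h.correctionBilin_symm]
    rfl⟩

theorem push_radicalDual :
    push ι (radicalDual ι J ξ n) = (fun _ : M ↦ (-1 : ℝ)) • fun q ↦ J (ι q) (push ι ξ q) :=
  funext fun q ↦ (h.mfderiv_tangentProj_J_radical q).trans (neg_one_smul ℝ _).symm

theorem push_transversalDual : push ι (transversalDual (E := E) ι J n) = fun q ↦ J (ι q) (n q) :=
  funext h.mfderiv_tangentProj_J_transversal

theorem smoothAlongAt_push (hY : IsSmoothField Y) (p : M) :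
    SmoothAlongAt (F := F) E ι (push ι Y) p :=
  LightlikeGeometry.smoothAlongAt_push (h.immersion.contMDiff p) hY

theorem isSmoothField_radicalDual : IsSmoothField (radicalDual ι J ξ n) := by
  intro p
  apply contMDiffAt_of_push h.immersion
  have hι := h.immersion.contMDiff p
  rw [h.push_radicalDual]
  exact SmoothAlongAt.smul hι contMDiffAt_const
    (h.kaehler.smoothAlongAt_J hι (h.smoothAlongAt_push h.radical.smooth p))

theorem isSmoothField_transversalDual : IsSmoothField (transversalDual (E := E) ι J n) := by
  intro p
  apply contMDiffAt_of_push h.immersion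
  rw [h.push_transversalDual]
  exact h.kaehler.smoothAlongAt_J (h.immersion.contMDiff p) (h.screen.smooth p)

theorem isSmoothField_inducedConnection [T2Space N] (hX : IsSmoothField X) (hY : IsSmoothField Y) :
    IsSmoothField fun p ↦ inducedConnection ι nabla n Y p (X p) := by
  intro p
  apply contMDiffAt_of_push h.immersion
  have e : push ι (fun p ↦ inducedConnection ι nabla n Y p (X p)) =
      fun p ↦ alongDeriv ι nabla (push ι Y) p (X p) :=
    funext fun q ↦ h.mfderiv_inducedConnection (hY.diffFieldAt q) (X q)
  rw [e]
  exact smoothAlongAt_alongDeriv h.kaehler.leviCivita.smooth h.immersion.contMDiff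
    (h.smoothAlongAt_push hY) hX

theorem contMDiff_inducedMetric (hX : IsSmoothField X) (hY : IsSmoothField Y) :
    ContMDiff 𝓘(ℝ, E) 𝓘(ℝ, ℝ) ∞ fun p ↦ inducedMetric ι g p (X p) (Y p) := fun p ↦
  h.kaehler.metric.contMDiffAt_apply (h.immersion.contMDiff p) (h.smoothAlongAt_push hX p)
    (h.smoothAlongAt_push hY p)

theorem contMDiff_eta (hX : IsSmoothField X) :
    ContMDiff 𝓘(ℝ, E) 𝓘(ℝ, ℝ) ∞ fun p ↦ eta ι g n p (X p) := fun p ↦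
  h.kaehler.metric.contMDiffAt_apply (h.immersion.contMDiff p) (h.screen.smooth p)
    (h.smoothAlongAt_push hX p)

theorem theta₀_eq (x : TangentSpace 𝓘(ℝ, E) p) :
    theta₀ ι g J ξ p x = inducedMetric ι g p (radicalDual ι J ξ n p) x :=
  (h.metric_J_radical x).symm

theorem isSmoothForm_theta₀ : IsSmoothForm (theta₀ ι g J ξ) := by
  intro X hX
  simp only [h.theta₀_eq]
  exact h.contMDiff_inducedMetric h.isSmoothField_radicalDual hX

theorem isSmoothField_screenProj (hY : IsSmoothField Y) : IsSmoothField (screenProj ι g ξ n Y) := by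
  rw [h.screenProj_eq]
  exact hY.add (IsSmoothField.smul (h.contMDiff_eta hY).neg h.radical.smooth)

theorem contMDiff_transversalForm [T2Space N] (hX : IsSmoothField X) (hY : IsSmoothField Y) :
    ContMDiff 𝓘(ℝ, E) 𝓘(ℝ, ℝ) ∞ fun p ↦ transversalForm ι g nabla ξ n p (X p) (Y p) := by
  have : ContMDiff 𝓘(ℝ, E) 𝓘(ℝ, ℝ) ∞ fun p ↦
      g (ι p) (alongDeriv ι nabla n p (X p)) (push ι (screenProj ι g ξ n Y) p) := fun p ↦
    h.kaehler.metric.contMDiffAt_apply (h.immersion.contMDiff p)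
      (smoothAlongAt_alongDeriv h.kaehler.leviCivita.smooth h.immersion.contMDiff
        h.screen.smooth hX)
      (h.smoothAlongAt_push (h.isSmoothField_screenProj hY) p)
  exact this.neg

theorem contMDiff_correctionBilin [T2Space N] (hX : IsSmoothField X) (hY : IsSmoothField Y) :
    ContMDiff 𝓘(ℝ, E) 𝓘(ℝ, ℝ) ∞ fun p ↦ correctionBilin ι g J nabla ξ n p (X p) (Y p) := by
  simp only [correctionBilin_apply]
  exact ((h.contMDiff_transversalForm hX hY).add
    ((h.contMDiff_eta hX).mul (h.isSmoothForm_theta₀ Y hY))).add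
      (((h.contMDiff_transversalForm h.radical.smooth hX).add (h.isSmoothForm_theta₀ X hX)).mul
        (h.contMDiff_eta hY))

theorem isSmoothField_weylDeriv [T2Space N] (hX : IsSmoothField X) (hY : IsSmoothField Y) :
    IsSmoothField fun p ↦ weylDeriv ι g J nabla ξ n Y p (X p) := by
  have e : (fun p ↦ weylDeriv ι g J nabla ξ n Y p (X p)) =
      (fun p ↦ inducedConnection ι nabla n Y p (X p)) + (fun p ↦ theta₀ ι g J ξ p (X p)) • Y +
        (fun p ↦ theta₀ ι g J ξ p (Y p)) • X +
        (fun p ↦ -inducedMetric ι g p (Y p) (X p)) • radicalDual ι J ξ n +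
        (fun p ↦ -correctionBilin ι g J nabla ξ n p (Y p) (X p)) • ξ := by
    funext p
    simp only [weylDeriv_apply, Pi.add_apply, Pi.smul_apply']
    module
  rw [e]
  exact ((((h.isSmoothField_inducedConnection hX hY).add
    (IsSmoothField.smul (h.isSmoothForm_theta₀ X hX) hY)).add
    (IsSmoothField.smul (h.isSmoothForm_theta₀ Y hY) hX)).add
    (IsSmoothField.smul (h.contMDiff_inducedMetric hY hX).neg h.isSmoothField_radicalDual)).add
    (IsSmoothField.smul (h.contMDiff_correctionBilin hY hX).neg h.radical.smooth)

/-- This is `D^{g₀} θ₀ = φ ⊗ θ₀`. It comes from `∇_x(-Jξ) = -J ∇_x ξ = φ(x)(-Jξ)` and metric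
compatibility. -/
theorem dirDeriv_theta₀ (hY : DiffFieldAt Y p) (x : TangentSpace 𝓘(ℝ, E) p) :
    dirDeriv (fun q ↦ theta₀ ι g J ξ q (Y q)) p x =
      phi ι g nabla ξ n p x * theta₀ ι g J ξ p (Y p) +
        theta₀ ι g J ξ p (inducedConnection ι nabla n Y p x) := by
  have hV := h.isSmoothField_radicalDual.diffFieldAt p
  have hξ := h.radical.smooth.diffFieldAt p
  have hι := h.mdifferentiableAt p
  simp only [h.theta₀_eq]
  rw [h.dirDeriv_inducedMetric hV hY]
  congr 1
  have h1 : mfderiv 𝓘(ℝ, E) 𝓘(ℝ, F) ι p (inducedConnection ι nabla n (radicalDual ι J ξ n) p x) =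
      phi ι g nabla ξ n p x • (-J (ι p) (push ι ξ p)) := by
    rw [h.mfderiv_inducedConnection hV, h.push_radicalDual,
      alongDeriv_smul hι mdifferentiableAt_const
      (h.kaehler.diffAlongAt_J hι (h.diffAlongAt_push hξ)),
      h.kaehler.alongDeriv_J hι (h.diffAlongAt_push hξ), ← h.mfderiv_inducedConnection hξ,
      h.inducedConnection_radical, map_smul, map_smul]
    have h0 : mvfderiv 𝓘(ℝ, E) (fun _ : M ↦ (-1 : ℝ)) p x = 0 := dirDeriv_const _ _
    rw [h0, zero_smul, add_zero, neg_one_smul, ← smul_neg]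
    rfl
  have h2 : mfderiv 𝓘(ℝ, E) 𝓘(ℝ, F) ι p (radicalDual ι J ξ n p) = -J (ι p) (push ι ξ p) :=
    h.mfderiv_tangentProj_J_radical p
  change g (ι p) (mfderiv 𝓘(ℝ, E) 𝓘(ℝ, F) ι p _) (mfderiv 𝓘(ℝ, E) 𝓘(ℝ, F) ι p (Y p)) =
    _ * g (ι p) (mfderiv 𝓘(ℝ, E) 𝓘(ℝ, F) ι p _) (mfderiv 𝓘(ℝ, E) 𝓘(ℝ, F) ι p (Y p))
  rw [h1, h2, map_smul, smul_apply, smul_eq_mul]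

/-- `dθ₀ = φ ∧ θ₀`: antisymmetrize `D^{g₀} θ₀ = φ ⊗ θ₀` and use that `D^{g₀}` is torsion-free. -/
theorem exteriorDeriv_theta₀ (hX : DiffFieldAt X p) (hY : DiffFieldAt Y p) :
    dirDeriv (fun q ↦ theta₀ ι g J ξ q (Y q)) p (X p) -
        dirDeriv (fun q ↦ theta₀ ι g J ξ q (X q)) p (Y p) -
        theta₀ ι g J ξ p (VectorField.mlieBracket 𝓘(ℝ, E) X Y p) =
      phi ι g nabla ξ n p (X p) * theta₀ ι g J ξ p (Y p) -
        phi ι g nabla ξ n p (Y p) * theta₀ ι g J ξ p (X p) := by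
  rw [h.dirDeriv_theta₀ hX, h.dirDeriv_theta₀ hY, ← h.inducedConnection_sub hX hY, map_sub]
  ring

end IsGeodesicLightlike
end

/-! ### The Weyl screen structure and the closedness criterion. -/

section
variable {E : Type*} [NormedAddCommGroup E] [NormedSpace ℝ E]
  {M : Type*} [TopologicalSpace M] [ChartedSpace E M] [IsManifold 𝓘(ℝ, E) ∞ M]
  {F : Type*} [NormedAddCommGroup F] [NormedSpace ℝ F]
  {N : Type*} [TopologicalSpace N] [ChartedSpace F N] [IsManifold 𝓘(ℝ, F) ∞ N]
  {nabla : CovariantDerivative 𝓘(ℝ, F) F (TangentSpace 𝓘(ℝ, F) : N → Type _)}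
  {g : ∀ x : N, TangentSpace 𝓘(ℝ, F) x →L[ℝ] TangentSpace 𝓘(ℝ, F) x →L[ℝ] ℝ} {ix : ℕ}
  {J : ∀ x : N, TangentSpace 𝓘(ℝ, F) x →L[ℝ] TangentSpace 𝓘(ℝ, F) x}
  {ι : M → N} {ξ : ∀ p : M, TangentSpace 𝓘(ℝ, E) p}
  {S : ∀ p : M, Submodule ℝ (TangentSpace 𝓘(ℝ, E) p)}
  {n : ∀ p : M, TangentSpace 𝓘(ℝ, F) (ι p)} {p : M}
variable [FiniteDimensional ℝ E] [FiniteDimensional ℝ F]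
  {D : CovariantDerivative 𝓘(ℝ, E) E (TangentSpace 𝓘(ℝ, E) : M → Type _)}

theorem IsWeylForm.unique
    {g₀ : ∀ p : M, TangentSpace 𝓘(ℝ, E) p →L[ℝ] TangentSpace 𝓘(ℝ, E) p →L[ℝ] ℝ}
    {θ θ' : ∀ p : M, TangentSpace 𝓘(ℝ, E) p →L[ℝ] ℝ} (hθ : IsWeylForm D g₀ θ)
    (hθ' : IsWeylForm D g₀ θ') (hg : ∀ p, g₀ p ≠ 0) : θ = θ' := by
  funext p
  obtain ⟨y, z, hyz⟩ : ∃ y z, g₀ p y z ≠ 0 := by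
    by_contra! hc
    exact hg p (by ext y z; exact hc y z)
  ext x
  have hy : DiffFieldAt (FiberBundle.extend E y) p := diffFieldAt_extend y
  have hz : DiffFieldAt (FiberBundle.extend E z) p := diffFieldAt_extend z
  have := (hθ p _ _ hy hz x).symm.trans (hθ' p _ _ hy hz x)
  rw [FiberBundle.extend_apply_self, FiberBundle.extend_apply_self] at this
  have := mul_right_cancel₀ hyz this
  linarith

theorem exteriorDeriv_dirDeriv {f : M → ℝ} (hf : ContMDiff 𝓘(ℝ, E) 𝓘(ℝ, ℝ) ∞ f)
    {X Y : ∀ q : M, TangentSpace 𝓘(ℝ, E) q} (hX : DiffFieldAt X p) (hY : DiffFieldAt Y p) :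
    dirDeriv (fun q ↦ mvfderiv 𝓘(ℝ, E) f q (Y q)) p (X p) -
        dirDeriv (fun q ↦ mvfderiv 𝓘(ℝ, E) f q (X q)) p (Y p) -
        mvfderiv 𝓘(ℝ, E) f p (VectorField.mlieBracket 𝓘(ℝ, E) X Y p) = 0 :=
  sub_eq_zero.2 (mvfderiv_commutator ((hf p).of_le (WithTop.coe_le_coe.2 le_top)) hX hY
    (mdifferentiableAt_mvfderiv_apply (hf p) hX) (mdifferentiableAt_mvfderiv_apply (hf p) hY))

namespace IsGeodesicLightlike

variable (h : IsGeodesicLightlike ι g J nabla ix ξ S n)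
  {X Y Z : ∀ q : M, TangentSpace 𝓘(ℝ, E) q}
include h

/-- The defining formula is tested on fields in the direction slot; extending a vector to a field
turns it into a pointwise statement. -/
theorem hasScreenData_apply (hD : HasScreenData ι g nabla ξ n (theta₀ ι g J ξ) D)
    (hY : DiffFieldAt Y p) (x : TangentSpace 𝓘(ℝ, E) p) :
    D Y p x = weylDeriv ι g J nabla ξ n Y p x := by
  have hx : DiffFieldAt (FiberBundle.extend E x) p := diffFieldAt_extend x
  have := hD p _ Y hx hY
  rw [h.correctionForm_eq hx hY, h.sharp_theta₀, h.inducedMetric_symm, h.correctionBilin_symm,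
    FiberBundle.extend_apply_self] at this
  exact this

theorem isSmoothConnection [T2Space N] (hD : HasScreenData ι g nabla ξ n (theta₀ ι g J ξ) D) :
    IsSmoothConnection D := by
  intro X Y hX hY
  have e : (fun p ↦ D Y p (X p)) = fun p ↦ weylDeriv ι g J nabla ξ n Y p (X p) :=
    funext fun p ↦ h.hasScreenData_apply hD (hY.diffFieldAt p) (X p)
  rw [e]
  exact h.isSmoothField_weylDeriv hX hY

theorem isTorsionFree (hD : HasScreenData ι g nabla ξ n (theta₀ ι g J ξ) D) :
    IsTorsionFree D := by
  intro p X Y hX hY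
  rw [h.hasScreenData_apply hD hY, h.hasScreenData_apply hD hX, ← h.inducedConnection_sub hX hY,
    weylDeriv_apply, weylDeriv_apply, h.inducedMetric_symm, h.correctionBilin_symm]
  module

theorem inducedMetric_weylDeriv (x : TangentSpace 𝓘(ℝ, E) p) (z : TangentSpace 𝓘(ℝ, E) p) :
    inducedMetric ι g p (weylDeriv ι g J nabla ξ n Y p x) z =
      inducedMetric ι g p (inducedConnection ι nabla n Y p x) z +
        theta₀ ι g J ξ p x * inducedMetric ι g p (Y p) z +
        theta₀ ι g J ξ p (Y p) * inducedMetric ι g p x z -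
        inducedMetric ι g p (Y p) x * theta₀ ι g J ξ p z := by
  rw [weylDeriv_apply]
  simp only [map_add, map_sub, map_smul, add_apply, sub_apply, smul_apply, smul_eq_mul,
    h.radical.radical, mul_zero, sub_zero, ← h.theta₀_eq]

theorem mdifferentiableAt_inducedMetric (hY : DiffFieldAt Y p) (hZ : DiffFieldAt Z p) :
    MDifferentiableAt 𝓘(ℝ, E) 𝓘(ℝ, ℝ) (fun q ↦ inducedMetric ι g q (Y q) (Z q)) p :=
  h.kaehler.metric.mdifferentiableAt_apply (h.mdifferentiableAt p) (h.diffAlongAt_push hY)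
    (h.diffAlongAt_push hZ)

theorem isWeylForm (hD : HasScreenData ι g nabla ξ n (theta₀ ι g J ξ) D) {f : M → ℝ}
    (hf : ContMDiff 𝓘(ℝ, E) 𝓘(ℝ, ℝ) ∞ f) :
    IsWeylForm D (conformalMetric (inducedMetric ι g) f)
      (fun p ↦ theta₀ ι g J ξ p + mvfderiv 𝓘(ℝ, E) f p) := by
  intro p Y Z hY hZ x
  have hfp : MDifferentiableAt 𝓘(ℝ, E) 𝓘(ℝ, ℝ) f p := (hf p).mdifferentiableAt (by simp)
  have hexp : MDifferentiableAt 𝓘(ℝ, E) 𝓘(ℝ, ℝ) (fun q ↦ Real.exp (-2 * f q)) p := by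
    have : Differentiable ℝ fun t : ℝ ↦ Real.exp (-2 * t) := by fun_prop
    exact (this (f p)).comp_mdifferentiableAt hfp
  have h1 : dirDeriv (fun q ↦ conformalMetric (inducedMetric ι g) f q (Y q) (Z q)) p x =
      Real.exp (-2 * f p) * dirDeriv (fun q ↦ inducedMetric ι g q (Y q) (Z q)) p x +
      Real.exp (-2 * f p) * (-2 * dirDeriv f p x) * inducedMetric ι g p (Y p) (Z p) := by
    rw [← dirDeriv_exp hfp]
    exact dirDeriv_smul hexp (h.mdifferentiableAt_inducedMetric hY hZ) x
  have h2 : ∀ y z : TangentSpace 𝓘(ℝ, E) p, conformalMetric (inducedMetric ι g) f p y z =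
      Real.exp (-2 * f p) * inducedMetric ι g p y z := fun _ _ ↦ rfl
  have h3 : (theta₀ ι g J ξ p + mvfderiv 𝓘(ℝ, E) f p) x = theta₀ ι g J ξ p x + dirDeriv f p x := rfl
  rw [covDerivTensor, h1, h2, h2, h2, h3, h.hasScreenData_apply hD hY,
    h.hasScreenData_apply hD hZ, h.inducedMetric_symm (Y p) (weylDeriv ι g J nabla ξ n Z p x),
    h.inducedMetric_weylDeriv, h.inducedMetric_weylDeriv, h.dirDeriv_inducedMetric hY hZ,
    h.inducedMetric_symm (Z p) (Y p), h.inducedMetric_symm x (Y p), h.inducedMetric_symm x (Z p),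
    h.inducedMetric_symm (Y p) (inducedConnection ι nabla n Z p x)]
  -- Adding the expansions for `Y` and `Z`, the terms `θ₀(Y) g₀(x, Z)` and `θ₀(Z) g₀(x, Y)` each
  -- occur with both signs and cancel. What remains is `2 θ₀(x) g₀(Y, Z)`, and the exponential
  -- contributes the `df` part.
  ring

theorem isSmoothForm {f : M → ℝ} (hf : ContMDiff 𝓘(ℝ, E) 𝓘(ℝ, ℝ) ∞ f) :
    IsSmoothForm (fun p ↦ theta₀ ι g J ξ p + mvfderiv 𝓘(ℝ, E) f p) := fun X hX ↦
  (h.isSmoothForm_theta₀ X hX).add fun p ↦ contMDiffAt_mvfderiv_apply (hf p) (hX p)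

theorem conformalMetric_ne_zero (f : M → ℝ) (p : M) :
    conformalMetric (inducedMetric (E := E) ι g) f p ≠ 0 := by
  intro h0
  have h1 : Real.exp (-2 * f p) *
      inducedMetric ι g p (radicalDual ι J ξ n p) (transversalDual (E := E) ι J n p) = 0 :=
    congrArg (fun L : TangentSpace 𝓘(ℝ, E) p →L[ℝ] TangentSpace 𝓘(ℝ, E) p →L[ℝ] ℝ ↦
      L (radicalDual ι J ξ n p) (transversalDual (E := E) ι J n p)) h0
  rw [← h.theta₀_eq, transversalDual, h.theta₀_J_transversal] at h1
  have := Real.exp_pos (-2 * f p)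
  linarith

theorem weylForm_unique (hD : HasScreenData ι g nabla ξ n (theta₀ ι g J ξ) D) {f : M → ℝ}
    (hf : ContMDiff 𝓘(ℝ, E) 𝓘(ℝ, ℝ) ∞ f) {θ : ∀ p : M, TangentSpace 𝓘(ℝ, E) p →L[ℝ] ℝ}
    (hθ : IsWeylForm D (conformalMetric (inducedMetric ι g) f) θ) :
    θ = fun p ↦ theta₀ ι g J ξ p + mvfderiv 𝓘(ℝ, E) f p :=
  hθ.unique (h.isWeylForm hD hf) (h.conformalMetric_ne_zero f)

theorem isWeylScreenStructure [T2Space N]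
    (hD : HasScreenData ι g nabla ξ n (theta₀ ι g J ξ) D) :
    IsWeylScreenStructure ι g ξ S n D where
  weyl :=
    { smooth := h.isSmoothConnection hD
      torsionFree := h.isTorsionFree hD
      preserves := fun _ hf ↦ ⟨_, ⟨h.isSmoothForm hf.smooth, h.isWeylForm hD hf.smooth⟩,
        fun _ hθ ↦ h.weylForm_unique hD hf.smooth hθ.2⟩ }
  parallel := by
    intro p Y hY x
    have hP := h.diffFieldAt_screenProj hY
    have hη := h.eta_screenProj Y p
    have hC : eta ι g n p (inducedConnection ι nabla n (screenProj ι g ξ n Y) p x) =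
        transversalForm ι g nabla ξ n p x (screenProj ι g ξ n Y p) := by
      refine (h.screenForm_screenProj hY x).trans ?_
      rw [screenProj, map_sub, map_smul, h.transversalForm_radical, smul_zero, sub_zero]
    have hV : eta ι g n p (radicalDual ι J ξ n p) = 0 := h.eta_J_radical p
    rw [h.mem_screen_iff, h.hasScreenData_apply hD hP, weylDeriv_apply, h.correctionBilin_symm,
      correctionBilin_apply]
    -- By `mem_screen_iff` it is enough that `η` vanishes. With `η(PY) = η(V) = 0` what remains is
    -- `C(x, PY) + η(x) θ₀(PY) - S(x, PY)`, which is zero by the choice of `S`.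
    simp only [map_add, map_sub, map_smul, smul_eq_mul, hη, hC, hV, h.eta_radical]
    ring

theorem phi_mul_theta₀_of_isClosed [T2Space M]
    (hcl : IsClosedForm (theta₀ ι g J ξ)) (x y : TangentSpace 𝓘(ℝ, E) p) :
    phi ι g nabla ξ n p x * theta₀ ι g J ξ p y = phi ι g nabla ξ n p y * theta₀ ι g J ξ p x := by
  obtain ⟨X, hX, rfl⟩ := exists_isSmoothField_eq x
  obtain ⟨Y, hY, rfl⟩ := exists_isSmoothField_eq y
  have := hcl X Y hX hY p
  rw [h.exteriorDeriv_theta₀ (hX.diffFieldAt p) (hY.diffFieldAt p)] at this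
  exact sub_eq_zero.1 this

theorem contMDiff_phi [T2Space N] (hX : IsSmoothField X) :
    ContMDiff 𝓘(ℝ, E) 𝓘(ℝ, ℝ) ∞ fun p ↦ phi ι g nabla ξ n p (X p) :=
  h.contMDiff_eta (h.isSmoothField_inducedConnection hX h.radical.smooth)

/-- `dθ₀ = φ ∧ θ₀ = l θ₀ ∧ θ₀ = 0` and `d(df) = 0`. -/
theorem isClosedForm {f : M → ℝ} (hf : ContMDiff 𝓘(ℝ, E) 𝓘(ℝ, ℝ) ∞ f) {l : M → ℝ}
    (hl : ∀ p, phi ι g nabla ξ n p = l p • theta₀ ι g J ξ p) :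
    IsClosedForm (fun p ↦ theta₀ ι g J ξ p + mvfderiv 𝓘(ℝ, E) f p) := by
  intro X Y hX hY p
  have hXp := hX.diffFieldAt p
  have hYp := hY.diffFieldAt p
  have hadd : ∀ (Y : ∀ q : M, TangentSpace 𝓘(ℝ, E) q) (_ : IsSmoothField Y)
      (x : TangentSpace 𝓘(ℝ, E) p),
      dirDeriv (fun q ↦ (theta₀ ι g J ξ q + mvfderiv 𝓘(ℝ, E) f q) (Y q)) p x =
        dirDeriv (fun q ↦ theta₀ ι g J ξ q (Y q)) p x +
          dirDeriv (fun q ↦ mvfderiv 𝓘(ℝ, E) f q (Y q)) p x := by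
    intro Y hY x
    have h1 : MDifferentiableAt 𝓘(ℝ, E) 𝓘(ℝ, ℝ) (fun q ↦ theta₀ ι g J ξ q (Y q)) p :=
      (h.isSmoothForm_theta₀ Y hY p).mdifferentiableAt (by simp)
    have h2 := mdifferentiableAt_mvfderiv_apply (hf p) (hY.diffFieldAt p)
    exact congrArg (fun L : TangentSpace 𝓘(ℝ, E) p →L[ℝ] ℝ ↦ L x) (mvfderiv_add h1 h2)
  have h1 := h.exteriorDeriv_theta₀ hXp hYp
  have h2 := exteriorDeriv_dirDeriv hf hXp hYp
  rw [hl, smul_apply, smul_apply, smul_eq_mul, smul_eq_mul] at h1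
  rw [hadd X hX, hadd Y hY, add_apply]
  linarith

theorem isClosedWeylStructure_iff [T2Space M] [T2Space N]
    (hD : HasScreenData ι g nabla ξ n (theta₀ ι g J ξ) D) :
    IsClosedWeylStructure (inducedMetric ι g) ξ D ↔
      ∃ l : M → ℝ, ContMDiff 𝓘(ℝ, E) 𝓘(ℝ, ℝ) ∞ l ∧
        ∀ p : M, phi ι g nabla ξ n p = l p • theta₀ ι g J ξ p := by
  constructor
  · intro hcl
    -- The metric `g₀` itself, with `f = 0`, suffices for this direction.
    have h0 : ContMDiff 𝓘(ℝ, E) 𝓘(ℝ, ℝ) ∞ fun _ : M ↦ (0 : ℝ) := contMDiff_const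
    have hcl' := hcl _ ⟨h0, fun p ↦ dirDeriv_const 0 (ξ p)⟩ _ (h.isSmoothForm h0)
      (h.isWeylForm hD h0)
    have e : (fun p ↦ theta₀ ι g J ξ p + mvfderiv 𝓘(ℝ, E) (fun _ : M ↦ (0 : ℝ)) p) =
        theta₀ ι g J ξ := by
      funext p
      ext x
      exact (congrArg (theta₀ ι g J ξ p x + ·) (dirDeriv_const 0 x)).trans (add_zero _)
    rw [e] at hcl'
    -- The factor comes from `φ(x) θ₀(U) = φ(U) θ₀(x)` with `θ₀(U) = -1`; it is globally smooth
    -- because `U` is.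
    refine ⟨fun p ↦ -phi ι g nabla ξ n p (transversalDual ι J n p),
      (h.contMDiff_phi h.isSmoothField_transversalDual).neg, fun p ↦ ?_⟩
    ext x
    have := h.phi_mul_theta₀_of_isClosed hcl' x (transversalDual ι J n p)
    have hU : theta₀ ι g J ξ p (transversalDual ι J n p) = -1 := h.theta₀_J_transversal p
    rw [hU] at this
    rw [smul_apply, smul_eq_mul]
    linarith
  · rintro ⟨l, -, hl⟩ f hf θ - hθ
    rw [h.weylForm_unique hD hf.smooth hθ]
    exact h.isClosedForm hf.smooth hl

end IsGeodesicLightlike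
end

end LightlikeGeometry

end

theorem mainTheorem2
    {F : Type*} [NormedAddCommGroup F] [NormedSpace ℝ F] [FiniteDimensional ℝ F]
    {N : Type*} [TopologicalSpace N] [T2Space N] [ChartedSpace F N] [IsManifold 𝓘(ℝ, F) ∞ N]
    {E : Type*} [NormedAddCommGroup E] [NormedSpace ℝ E] [FiniteDimensional ℝ E]
    {M : Type*} [TopologicalSpace M] [T2Space M] [ChartedSpace E M] [IsManifold 𝓘(ℝ, E) ∞ M]
    (m ν : ℕ) (hm : 1 < m) (hν : 0 < ν) (hνm : ν < m)
    (hF : finrank ℝ F = 2 * m) (hE : finrank ℝ E + 1 = 2 * m)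
    (g : ∀ x : N, TangentSpace 𝓘(ℝ, F) x →L[ℝ] TangentSpace 𝓘(ℝ, F) x →L[ℝ] ℝ)
    (J : ∀ x : N, TangentSpace 𝓘(ℝ, F) x →L[ℝ] TangentSpace 𝓘(ℝ, F) x)
    (nabla : CovariantDerivative 𝓘(ℝ, F) F (TangentSpace 𝓘(ℝ, F) : N → Type _))
    (hK : LightlikeGeometry.IsIndefiniteKaehler g J nabla (2 * ν))
    (ι : M → N) (hι : Manifold.IsImmersion 𝓘(ℝ, E) 𝓘(ℝ, F) ∞ ι)
    (ξ : ∀ p : M, TangentSpace 𝓘(ℝ, E) p)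
    (hξ : LightlikeGeometry.IsRadicalSection ι g ξ)
    (S : ∀ p : M, Submodule ℝ (TangentSpace 𝓘(ℝ, E) p))
    (n : ∀ p : M, TangentSpace 𝓘(ℝ, F) (ι p))
    (hS : LightlikeGeometry.IsScreen ι g ξ S n)
    (hSJ : LightlikeGeometry.IsAdaptedScreen ι g J ξ S n)
    (hgeo : LightlikeGeometry.IsTotallyGeodesic ι g nabla ξ)
    (hC : LightlikeGeometry.IsSymmetricScreenForm ι g nabla S n) :
    (∃ D : CovariantDerivative 𝓘(ℝ, E) E (TangentSpace 𝓘(ℝ, E) : M → Type _),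
      LightlikeGeometry.HasScreenData ι g nabla ξ n (LightlikeGeometry.theta₀ ι g J ξ) D) ∧
    ∀ D : CovariantDerivative 𝓘(ℝ, E) E (TangentSpace 𝓘(ℝ, E) : M → Type _),
      LightlikeGeometry.HasScreenData ι g nabla ξ n (LightlikeGeometry.theta₀ ι g J ξ) D →
      LightlikeGeometry.IsWeylScreenStructure ι g ξ S n D ∧
      (∀ f : M → ℝ, LightlikeGeometry.IsConformalFactor ξ f →
        LightlikeGeometry.IsSmoothForm
          (fun p ↦ LightlikeGeometry.theta₀ ι g J ξ p + mvfderiv 𝓘(ℝ, E) f p) ∧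
        LightlikeGeometry.IsWeylForm D
          (LightlikeGeometry.conformalMetric (LightlikeGeometry.inducedMetric ι g) f)
          (fun p ↦ LightlikeGeometry.theta₀ ι g J ξ p + mvfderiv 𝓘(ℝ, E) f p)) ∧
      (LightlikeGeometry.IsClosedWeylStructure (LightlikeGeometry.inducedMetric ι g) ξ D ↔
        ∃ l : M → ℝ, ContMDiff 𝓘(ℝ, E) 𝓘(ℝ, ℝ) ∞ l ∧
          ∀ p : M, LightlikeGeometry.phi ι g nabla ξ n p =
            l p • LightlikeGeometry.theta₀ ι g J ξ p) := by
  have h : LightlikeGeometry.IsGeodesicLightlike ι g J nabla (2 * ν) ξ S n :=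
    ⟨hE.trans hF.symm, hK, hι, hξ, hS, hSJ, hgeo, hC⟩
  exact ⟨h.exists_hasScreenData, fun D hD ↦ ⟨h.isWeylScreenStructure hD,
    fun f hf ↦ ⟨h.isSmoothForm hf.smooth, h.isWeylForm hD hf.smooth⟩,
    h.isClosedWeylStructure_iff hD⟩⟩
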